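/- Let $N\ge 2$, $T>0$, $p>1$. Let $(e_i)_{1\le i\le N}$ be the canonical basis of $\mathbb R^N$, $J_i=\mathbb R_+e_i$, and let $\mathcal G=\bigcup_i J_i\subset\mathbb R^N$ be the junction with vertex $0$. For $t\in[0,T)$ and $x\in\mathcal G$ let $\Gamma_t[x]$ be the set of $y\in W^{1,p}(t,T;\mathbb R^N)\cap C([t,T];\mathcal G)$ with $y(t)=x$. Let $\ell_i\in C(\mathbb R_+\times\mathbb R\times[0,T])$ $(1\le i\le N)$ be such that $\ell_i(\cdot,\cdot,s)$ is differentiable on $\mathbb R_+\times\mathbb R$ for each $s$, with $\partial_y\ell_i,\partial_a\ell_i$ continuous in $(y,a,s)$, and let $\ell_*\in C([0,T])$. Assume: * [H1] there are $C_0>0$, $c_0\in\mathbb R$ with $\ell_i(y,a,s)\ge C_0|a|^p+c_0$ and $\ell_*(s)\ge c_0$ for all $i,y,a,s$; * [H2] for every $r>0$ there is a modulus of continuity $\omega_r$ with $|\ell_i(y,a,t_1)-\ell_i(y,a,t_2)|\le(1+|a|^p)\,\omega_r(|t_1-t_2|)$ for all $i$, $y\in[0,r]$, $a\in\mathbb R$,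 $t_1,t_2\in[0,T]$; * [H3] for every $r>0$ there is $\tilde c(r)\ge0$ with $|\partial_y\ell_i(y,a,s)|\le\tilde c(r)(|a|^p+1)$ and $|\partial_a\ell_i(y,a,s)|\le\tilde c(r)(|a|^{p-1}+1)$ for all $i$, $y\in[0,r]$, $a\in\mathbb R$, $s\in[0,T]$; * [H4] $a\mapsto\ell_i(y,a,s)$ is strictly convex. Set $\ell_0(s)=\min\{\ell_*(s),\min_i\ell_i(0,0,s)\}$. For $z\in\mathcal G$ set $L(z,a,s)=\ell_i(|z|,a\cdot e_i,s)$ if $z\in J_i\setminus\{0\}$ and $L(0,a,s)=\ell_0(s)$, and for $y\in\Gamma_t[x]$ set $j(y)=\int_t^T L(y(\tau),y'(\tau),\tau)\,d\tau$, where $y'$ is the weak derivative of $y$. Define $\phi:\mathbb R^N\times\mathbb R^N\times[0,T]\to(-\infty,+\infty]$ as follows. Let $\ell(z,a,s)=\ell_i(z\cdot e_i,a\cdot e_i,s)$ if $(z,a)\in J_i\times\mathbb Re_i\setminus\{(0,0)\}$, $\ell(0,0,s)=\min_i\ell_i(0,0,s)$, and $\ell(z,a,s)=+\infty$ otherwise.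 Let $\chi_0(0)=0$ and $\chi_0(a)=+\infty$ for $a\neq0$. Let $\mathcal L_0(\cdot,s)$ be the greatest convex function on $\mathbb R^N$ majorized by both $\ell(0,\cdot,s)$ and $\ell_0(s)+\chi_0$. Put $\phi(0,a,s)=\mathcal L_0(a,s)$ and $\phi(z,a,s)=\ell(z,a,s)$ for $z\ne0$. Then: 1. For every $t\in[0,T)$ and $x\in\mathcal G$: (a) $\tau\mapsto L(y(\tau),y'(\tau),\tau)$ is integrable on $(t,T)$ for each $y\in\Gamma_t[x]$, so $j$ is well defined and finite on $\Gamma_t[x]$; (b) $j$ is lower semicontinuous on $\Gamma_t[x]$ for the weak topology of $W^{1,p}(t,T;\mathbb R^N)$; (c) if $y^n\in\Gamma_t[x]$ and $y^n\rightharpoonup y$ weakly in $W^{1,p}(t,T;\mathbb R^N)$, then $y\in\Gamma_t[x]$ and $\liminf_n j(y^n)\ge j(y)$; (d) for each $y\in\Gamma_t[x]$, $\phi(y(s),y'(s),s)=L(y(s),y'(s),s)$ for a.e. $s\in(t,T)$. 2. $\mathcal L_0$ is real-valued on $\mathbb R^N\times[0,T]$; $\mathcal L_0(0,s)=\ell_0(s)$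 for every $s\in[0,T]$; for each $a\in\mathbb R^N$, $\mathcal L_0(a,\cdot)$ is lower semicontinuous on $[0,T]$; and $\mathcal L_0$ is measurable for the product of the Borel $\sigma$-algebra of $\mathbb R^N$ and the Lebesgue $\sigma$-algebra of $[0,T]$. 3. $\phi>-\infty$ on $\mathbb R^N\times\mathbb R^N\times[0,T]$; $\phi$ is measurable for the product of the Borel $\sigma$-algebras of the two copies of $\mathbb R^N$ and the Lebesgue $\sigma$-algebra of $[0,T]$; for each $s\in[0,T]$, $\phi(\cdot,\cdot,s)$ is lower semicontinuous on $\mathbb R^N\times\mathbb R^N$; and for each $(z,s)\in\mathbb R^N\times[0,T]$, $\phi(z,\cdot,s)$ is convex. -/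

import Mathlib

open MeasureTheory Set Filter Topology
open scoped ENNReal ContDiff

noncomputable section

namespace JunctionControl

/-- The ambient Euclidean space `ℝ^N`. -/
abbrev Space (N : ℕ) : Type := EuclideanSpace ℝ (Fin N)

/-- The line `ℝ e_i` in `ℝ^N`. -/
def axisLine {N : ℕ} (i : Fin N) : Set (Space N) :=
  {a | ∃ r : ℝ, a = r • EuclideanSpace.single i (1 : ℝ)}

/-- The edge `J_i = ℝ_+ e_i`. -/
def edge {N : ℕ} (i : Fin N) : Set (Space N) :=
  {z | ∃ r : ℝ, 0 ≤ r ∧ z = r • EuclideanSpace.single i (1 : ℝ)}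

/-- The junction with `N` edges glued at the vertex `0`. -/
def junction (N : ℕ) : Set (Space N) := ⋃ i : Fin N, edge i

/-! Sobolev space on an interval -/

instance factOneLe {p : ℝ} [h : Fact (1 < p)] : Fact (1 ≤ ENNReal.ofReal p) :=
  ⟨by simpa using h.out.le⟩

/-- Lebesgue measure on the open interval `(t, T)`. -/
abbrev intervalMeasure (t T : ℝ) : Measure ℝ := volume.restrict (Ioo t T)

/-- `L^p(t, T; ℝ^N)`. -/
abbrev LpSpace (N : ℕ) (p t T : ℝ) : Type :=
  Lp (Space N) (ENNReal.ofReal p) (intervalMeasure t T)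

/-- `v` is the weak derivative of `u` on `(t, T)`. -/
def IsWeakDeriv {N : ℕ} (t T : ℝ) (u v : ℝ → Space N) : Prop :=
  ∀ η : ℝ → ℝ, ContDiff ℝ ∞ η → HasCompactSupport η → tsupport η ⊆ Ioo t T →
    ∫ s in Ioo t T, deriv η s • u s = - ∫ s in Ioo t T, η s • v s

theorem integrable_smul_Lp {N : ℕ} {p t T : ℝ} [Fact (1 < p)] (u : LpSpace N p t T)
    {η : ℝ → ℝ} (hη : Continuous η) (hc : HasCompactSupport η) :
    Integrable (fun s => η s • u s) (intervalMeasure t T) := by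
  have hu : Integrable u (intervalMeasure t T) :=
    (Lp.memLp u).integrable factOneLe.out
  obtain ⟨C, hC⟩ := hc.exists_bound_of_continuous hη
  exact hu.bdd_smul C hη.aestronglyMeasurable (Eventually.of_forall hC)

/-- The Sobolev space `W^{1,p}(t, T; ℝ^N)`: pairs `(u, u')` in `L^p × L^p` where `u'` is the weak
derivative of `u`, with the norm `(‖u‖_p ^ p + ‖u'‖_p ^ p) ^ (1 / p)`. -/
def sobolev (N : ℕ) (p t T : ℝ) [Fact (1 < p)] :
    Submodule ℝ (WithLp (ENNReal.ofReal p) (LpSpace N p t T × LpSpace N p t T)) where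
  carrier := {Y | IsWeakDeriv t T Y.fst Y.snd}
  zero_mem' := by
    intro η h1 h2 _
    have h0 : ∀ ζ : ℝ → ℝ, ∫ s in Ioo t T, ζ s • (0 : LpSpace N p t T) s = 0 := by
      intro ζ
      rw [integral_eq_zero_of_ae]
      filter_upwards [Lp.coeFn_zero (Space N) (ENNReal.ofReal p) (intervalMeasure t T)] with s hs
      rw [hs]
      simp
    have e1 : (0 : WithLp (ENNReal.ofReal p) (LpSpace N p t T × LpSpace N p t T)).fst = 0 := rfl
    have e2 : (0 : WithLp (ENNReal.ofReal p) (LpSpace N p t T × LpSpace N p t T)).snd = 0 := rfl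
    rw [e1, e2, h0, h0, neg_zero]
  add_mem' := by
    intro Y Z hY hZ η h1 h2 h3
    have key : ∀ ζ : ℝ → ℝ, Continuous ζ → HasCompactSupport ζ → ∀ u w : LpSpace N p t T,
        ∫ s in Ioo t T, ζ s • (u + w) s
          = (∫ s in Ioo t T, ζ s • u s) + ∫ s in Ioo t T, ζ s • w s := by
      intro ζ hζ hc u w
      rw [← integral_add (integrable_smul_Lp u hζ hc) (integrable_smul_Lp w hζ hc)]
      refine integral_congr_ae ?_
      filter_upwards [Lp.coeFn_add u w] with s hs
      rw [hs, Pi.add_apply, smul_add]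
    have e1 : (Y + Z).fst = Y.fst + Z.fst := rfl
    have e2 : (Y + Z).snd = Y.snd + Z.snd := rfl
    have hd : Continuous (deriv η) := h1.continuous_deriv (by simp)
    rw [e1, e2, key _ hd h2.deriv, key _ h1.continuous h2, hY η h1 h2 h3, hZ η h1 h2 h3]
    abel
  smul_mem' := by
    intro c Y hY η h1 h2 h3
    have key : ∀ ζ : ℝ → ℝ, ∀ u : LpSpace N p t T,
        ∫ s in Ioo t T, ζ s • (c • u) s = c • ∫ s in Ioo t T, ζ s • u s := by
      intro ζ u
      rw [← integral_smul]
      refine integral_congr_ae ?_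
      filter_upwards [Lp.coeFn_smul c u] with s hs
      simp [hs, smul_comm c]
    have e1 : (c • Y).fst = c • Y.fst := rfl
    have e2 : (c • Y).snd = c • Y.snd := rfl
    rw [e1, e2, key, key, hY η h1 h2 h3, smul_neg]

/-- `W^{1,p}(t, T; ℝ^N)` as a normed space. -/
abbrev Sobolev (N : ℕ) (p t T : ℝ) [Fact (1 < p)] : Type := sobolev N p t T

/-- (A representative of) the function underlying `Y ∈ W^{1,p}(t, T; ℝ^N)`. -/
def pos {N : ℕ} {p t T : ℝ} [Fact (1 < p)] (Y : Sobolev N p t T) : ℝ → Space N :=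
  fun s => Y.1.fst s

/-- (A representative of) the weak derivative of `Y ∈ W^{1,p}(t, T; ℝ^N)`. -/
def vel {N : ℕ} {p t T : ℝ} [Fact (1 < p)] (Y : Sobolev N p t T) : ℝ → Space N :=
  fun s => Y.1.snd s

/-- `Γ_t[x]`: the elements of `W^{1,p}(t, T; ℝ^N)` that have a representative which is continuous
on `[t, T]`, takes its values in the junction, and starts from `x` at time `t`. -/
def admissible {N : ℕ} (p t T : ℝ) [Fact (1 < p)] (x : Space N) : Set (Sobolev N p t T) :=
  {Y | ∃ y : ℝ → Space N, ContinuousOn y (Icc t T) ∧ (∀ s ∈ Icc t T, y s ∈ junction N) ∧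
    y t = x ∧ pos Y =ᵐ[intervalMeasure t T] y}

/-! Running costs -/

/-- A modulus of continuity on `[0, ∞)`. -/
structure IsModulus (m : ℝ → ℝ) : Prop where
  zero : m 0 = 0
  mono : MonotoneOn m (Ici 0)
  cont : ContinuousWithinAt m (Ici 0) 0

/-- Standing assumptions on the edge costs `ℓ i y a s` (`y ≥ 0`, `a ∈ ℝ`, `s ∈ [0, T]`) and on the
specific cost `ℓs` at the vertex. At `y = 0` the derivative in `y` is one-sided. -/
structure IsRunningCost {N : ℕ} (p T : ℝ) (ℓ : Fin N → ℝ → ℝ → ℝ → ℝ) (ℓs : ℝ → ℝ) : Prop where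
  continuousOn : ∀ i, ContinuousOn (fun q : ℝ × ℝ × ℝ => ℓ i q.1 q.2.1 q.2.2)
    (Ici 0 ×ˢ univ ×ˢ Icc 0 T)
  differentiableOn : ∀ i, ∀ s ∈ Icc 0 T,
    DifferentiableOn ℝ (fun q : ℝ × ℝ => ℓ i q.1 q.2 s) (Ici 0 ×ˢ univ)
  continuousOn_deriv_pos : ∀ i, ContinuousOn
    (fun q : ℝ × ℝ × ℝ => derivWithin (fun y => ℓ i y q.2.1 q.2.2) (Ici 0) q.1)
    (Ici 0 ×ˢ univ ×ˢ Icc 0 T)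
  continuousOn_deriv_vel : ∀ i, ContinuousOn
    (fun q : ℝ × ℝ × ℝ => deriv (fun a => ℓ i q.1 a q.2.2) q.2.1)
    (Ici 0 ×ˢ univ ×ˢ Icc 0 T)
  continuousOn_vertex : ContinuousOn ℓs (Icc 0 T)
  coercive : ∃ C₀ : ℝ, 0 < C₀ ∧ ∃ c₀ : ℝ,
    (∀ i, ∀ y ≥ 0, ∀ a : ℝ, ∀ s ∈ Icc 0 T, C₀ * |a| ^ p + c₀ ≤ ℓ i y a s) ∧
    ∀ s ∈ Icc 0 T, c₀ ≤ ℓs s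
  modulus : ∀ r : ℝ, 0 < r → ∃ m : ℝ → ℝ, IsModulus m ∧
    ∀ i, ∀ y ∈ Icc 0 r, ∀ a : ℝ, ∀ t₁ ∈ Icc 0 T, ∀ t₂ ∈ Icc 0 T,
      |ℓ i y a t₁ - ℓ i y a t₂| ≤ (1 + |a| ^ p) * m |t₁ - t₂|
  deriv_bound : ∀ r : ℝ, 0 < r → ∃ c : ℝ, 0 ≤ c ∧ ∀ i, ∀ y ∈ Icc 0 r, ∀ a : ℝ, ∀ s ∈ Icc 0 T,
    |derivWithin (fun y => ℓ i y a s) (Ici 0) y| ≤ c * (|a| ^ p + 1) ∧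
    |deriv (fun a => ℓ i y a s) a| ≤ c * (|a| ^ (p - 1) + 1)
  strictConvex : ∀ i, ∀ y ≥ 0, ∀ s ∈ Icc 0 T, StrictConvexOn ℝ univ (fun a => ℓ i y a s)

/-- `ℓ_0(s) = min {ℓ_*(s), min_i ℓ_i(0, 0, s)}`, the cost for staying at the vertex. -/
def vertexCost {N : ℕ} (ℓ : Fin N → ℝ → ℝ → ℝ → ℝ) (ℓs : ℝ → ℝ) (s : ℝ) : ℝ :=
  min (ℓs s) (⨅ i, ℓ i 0 0 s)

open Classical in
/-- The running cost `L(z, a, s)` for `z` in the junction. For `z ∈ J_i \ {0}` the velocity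
is `a = (a i) e_i`, and `a i` is the scalar velocity. -/
def runningCost {N : ℕ} (ℓ : Fin N → ℝ → ℝ → ℝ → ℝ) (ℓs : ℝ → ℝ) (z a : Space N) (s : ℝ) : ℝ :=
  (∑ i, if z ∈ edge i \ {0} then ℓ i ‖z‖ (a i) s else 0) +
    if z = 0 then vertexCost ℓ ℓs s else 0

/-- The integrand `s ↦ L(y(s), y'(s), s)`. -/
def costAlong {N : ℕ} {p t T : ℝ} [Fact (1 < p)] (ℓ : Fin N → ℝ → ℝ → ℝ → ℝ) (ℓs : ℝ → ℝ)
    (Y : Sobolev N p t T) (s : ℝ) : ℝ :=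
  runningCost ℓ ℓs (pos Y s) (vel Y s) s

/-- The functional `j(y) = ∫_t^T L(y(s), y'(s), s) ds`. -/
def costFunctional {N : ℕ} {p t T : ℝ} [Fact (1 < p)] (ℓ : Fin N → ℝ → ℝ → ℝ → ℝ) (ℓs : ℝ → ℝ)
    (Y : Sobolev N p t T) : ℝ :=
  ∫ s in Ioo t T, costAlong ℓ ℓs Y s

/-! The extended integrand -/

/-- Convexity of an extended-real-valued function: its epigraph is convex. -/
def EConvex {E : Type*} [AddCommGroup E] [Module ℝ E] (f : E → EReal) : Prop :=
  Convex ℝ {q : E × ℝ | f q.1 ≤ (q.2 : EReal)}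

/-- The convex envelope of a collection `F` of functions: the supremum of the convex functions
that are majorized by every member of `F` (it is itself convex, so it is the greatest one). -/
def convexEnvelope {E : Type*} [AddCommGroup E] [Module ℝ E] (F : Set (E → EReal)) (x : E) :
    EReal :=
  ⨆ g ∈ {g : E → EReal | EConvex g ∧ ∀ f ∈ F, g ≤ f}, g x

open Classical in
/-- The function `ℓ(z, a, s)`. If `(z, a) ≠ (0, 0)` lies in `J_i × ℝ e_i`, then `i` is unique and
the infimum below is the single value `ℓ_i(z · e_i, a · e_i, s)`; if there is no such `i`, the
infimum is `+∞`. -/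
def ellExt {N : ℕ} (ℓ : Fin N → ℝ → ℝ → ℝ → ℝ) (z a : Space N) (s : ℝ) : EReal :=
  if z = 0 ∧ a = 0 then ((⨅ i, ℓ i 0 0 s : ℝ) : EReal)
  else ⨅ (i : Fin N) (_ : z ∈ edge i ∧ a ∈ axisLine i), (ℓ i (z i) (a i) s : EReal)

open Classical in
/-- The function equal to `0` at `0` and to `+∞` elsewhere. -/
def chiZero {N : ℕ} (a : Space N) : EReal := if a = 0 then 0 else ⊤

/-- `ℒ_0(a, s)`: the convex envelope in `a` of `ℓ(0, ·, s)` and `ℓ_0(s) + χ_0`. -/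
def vertexEnvelope {N : ℕ} (ℓ : Fin N → ℝ → ℝ → ℝ → ℝ) (ℓs : ℝ → ℝ) (a : Space N) (s : ℝ) :
    EReal :=
  convexEnvelope {fun b => ellExt ℓ 0 b s, fun b => (vertexCost ℓ ℓs s : EReal) + chiZero b} a

open Classical in
/-- The extended integrand `φ(z, a, s)`. -/
def phi {N : ℕ} (ℓ : Fin N → ℝ → ℝ → ℝ → ℝ) (ℓs : ℝ → ℝ) (z a : Space N) (s : ℝ) : EReal :=
  if z = 0 then vertexEnvelope ℓ ℓs a s else ellExt ℓ z a s

/-- The Lebesgue `σ`-algebra on `[0, T]`. -/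
@[reducible]
def lebesgueSigma (T : ℝ) : MeasurableSpace (Icc (0 : ℝ) T) :=
  (inferInstance : MeasurableSpace
    (NullMeasurableSpace (Icc (0 : ℝ) T) (Measure.comap Subtype.val volume)))

end JunctionControl

end

open JunctionControl

namespace JunctionControl

section

variable {N : ℕ}

/-! ### Geometry of the junction -/

/-! An admissible curve agrees almost everywhere with a continuous primitive of its weak derivative.
The derivative of an absolutely continuous function vanishes a.e. on each level set; applied
coordinatewise, this shows that at almost every time the curve is either at rest at the vertex or
inside an edge with velocity along it (`ae_vertex_or_edge`). Integrability of the cost, its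
coercivity along curves and the identity `phi = L` all follow from this dichotomy, the last one
because ℒ_0(0, s) = ℓ_0(s).

Lower semicontinuity of the functional is proved directly from tangent lines. Fix a curve Z and a
level c < j(Z). By coercivity, a curve Y with j(Y) ≤ c has bounded p-energy; bounded energy gives
equicontinuity, so weak closeness to Z becomes uniform closeness. On a large set of times where Z'
is bounded and Z is either at 0 or away from 0, convexity in the velocity bounds the cost of Y below
by that of Z, plus a term linear in Y' - Z', minus a small error (`costAlong_ge_of_close`). At the
vertex this uses only ℓ_0 ≤ ℓ_i(0, 0, ·); away from it, Y must lie on the same edge as Z. The linear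
term has bounded weights, hence is weakly continuous; on the remaining times the cost is at least
c₀. The argument works with weak neighbourhoods, so it gives topological and not merely sequential
semicontinuity.

The envelope ℒ_0 is finite because it has an affine minorant (tangents at zero velocity) and every
vector is a mean of vectors on the axes. Being finite and convex, it is continuous in a.
Semicontinuity in s comes from rescaling ℒ_0(·, s) into a competitor for the envelope at a nearby
time. Finally, `phi` is a finite infimum of functions that are finite only on closed sets, which
gives its semicontinuity and measurability. -/

theorem mem_axisLine_iff {i : Fin N} {a : Space N} : a ∈ axisLine i ↔ ∀ j, j ≠ i → a j = 0 := by
  constructor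
  · rintro ⟨r, rfl⟩ j hj
    simp [hj]
  · intro h
    refine ⟨a i, ?_⟩
    ext j
    by_cases hj : j = i
    · subst hj; simp
    · simp [hj, h j hj]

theorem mem_edge_iff {i : Fin N} {z : Space N} :
    z ∈ edge i ↔ 0 ≤ z i ∧ ∀ j, j ≠ i → z j = 0 := by
  constructor
  · rintro ⟨r, hr, rfl⟩
    refine ⟨by simpa using hr, fun j hj => by simp [hj]⟩
  · rintro ⟨h0, h⟩
    obtain ⟨r, hr⟩ := mem_axisLine_iff.2 h
    refine ⟨r, ?_, hr⟩
    rw [hr] at h0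
    simpa using h0

theorem edge_subset_axisLine (i : Fin N) : edge i ⊆ axisLine i := by
  rintro z ⟨r, -, h⟩
  exact ⟨r, h⟩

theorem zero_mem_edge (i : Fin N) : (0 : Space N) ∈ edge i := mem_edge_iff.2 (by simp)

theorem eq_zero_of_mem_axisLine {i : Fin N} {z : Space N} (h : z ∈ axisLine i) (h0 : z i = 0) :
    z = 0 := by
  ext j
  by_cases hj : j = i
  · simpa [hj] using h0
  · simpa using mem_axisLine_iff.1 h j hj

theorem coord_pos_of_mem_edge {i : Fin N} {z : Space N} (h : z ∈ edge i) (h0 : z ≠ 0) :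
    0 < z i :=
  lt_of_le_of_ne (mem_edge_iff.1 h).1
    fun h' => h0 (eq_zero_of_mem_axisLine (edge_subset_axisLine i h) h'.symm)

theorem edge_index_unique {i j : Fin N} {z : Space N} (hi : z ∈ edge i) (hj : z ∈ edge j)
    (h0 : z ≠ 0) : j = i := by
  by_contra hji
  exact (coord_pos_of_mem_edge hj h0).ne' ((mem_edge_iff.1 hi).2 j hji)

theorem norm_of_mem_axisLine {i : Fin N} {a : Space N} (h : a ∈ axisLine i) : ‖a‖ = |a i| := by
  obtain ⟨r, rfl⟩ := h
  simp [norm_smul]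

theorem norm_of_mem_edge {i : Fin N} {z : Space N} (h : z ∈ edge i) : ‖z‖ = z i := by
  rw [norm_of_mem_axisLine (edge_subset_axisLine i h), abs_of_nonneg (mem_edge_iff.1 h).1]

theorem isClosed_axisLine (i : Fin N) : IsClosed (axisLine i : Set (Space N)) := by
  have : (axisLine i : Set (Space N)) = ⋂ j, ⋂ _ : j ≠ i, {a : Space N | a j = 0} := by
    ext a; simp [mem_axisLine_iff]
  rw [this]
  exact isClosed_iInter fun j => isClosed_iInter fun _ =>
    isClosed_eq (by fun_prop) continuous_const

theorem isClosed_edge (i : Fin N) : IsClosed (edge i : Set (Space N)) := by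
  have : (edge i : Set (Space N)) = {z : Space N | 0 ≤ z i} ∩ axisLine i := by
    ext a; simp [mem_edge_iff, mem_axisLine_iff]
  rw [this]
  exact (isClosed_le continuous_const (by fun_prop)).inter (isClosed_axisLine i)

theorem isClosed_junction : IsClosed (junction N) :=
  isClosed_iUnion_of_finite isClosed_edge

theorem convex_axisLine (i : Fin N) : Convex ℝ (axisLine i : Set (Space N)) := by
  intro a ha b hb s t _ _ _
  rw [mem_axisLine_iff] at *
  intro j hj
  simp [ha j hj, hb j hj]

/-! ### Running costs -/

theorem runningCost_zero (ℓ : Fin N → ℝ → ℝ → ℝ → ℝ) (ℓs : ℝ → ℝ) (a : Space N) (s : ℝ) :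
    runningCost ℓ ℓs 0 a s = vertexCost ℓ ℓs s := by
  simp [runningCost]

theorem runningCost_of_mem_edge (ℓ : Fin N → ℝ → ℝ → ℝ → ℝ) (ℓs : ℝ → ℝ) {i : Fin N}
    {z : Space N} (hz : z ∈ edge i) (h0 : z ≠ 0) (a : Space N) (s : ℝ) :
    runningCost ℓ ℓs z a s = ℓ i (z i) (a i) s := by
  unfold runningCost
  rw [if_neg h0, add_zero, Finset.sum_eq_single i]
  · rw [if_pos ⟨hz, h0⟩, norm_of_mem_edge hz]
  · intro j _ hj
    exact if_neg fun h => hj (edge_index_unique hz h.1 h0)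
  · simp

/-- The projection of `ℝ` onto `[0, T]`. -/
noncomputable def clampTime (T s : ℝ) : ℝ := max 0 (min s T)

theorem clampTime_mem {T : ℝ} (hT : 0 ≤ T) (s : ℝ) : clampTime T s ∈ Icc 0 T :=
  ⟨le_max_left _ _, max_le hT (min_le_right _ _)⟩

theorem clampTime_of_mem {T s : ℝ} (hs : s ∈ Icc 0 T) : clampTime T s = s := by
  rw [clampTime, min_eq_left hs.2, max_eq_right hs.1]

theorem continuous_clampTime (T : ℝ) : Continuous (clampTime T) := by
  unfold clampTime; fun_prop

/-- The extension of `ℓ_i` to a function on `ℝ × ℝ × ℝ`. -/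
noncomputable def costExt (T : ℝ) (ℓ : Fin N → ℝ → ℝ → ℝ → ℝ) (i : Fin N) (q : ℝ × ℝ × ℝ) : ℝ :=
  ℓ i (max 0 q.1) q.2.1 (clampTime T q.2.2)

/-- The extension of `∂_a ℓ_i` to a function on `ℝ × ℝ × ℝ`. -/
noncomputable def slopeExt (T : ℝ) (ℓ : Fin N → ℝ → ℝ → ℝ → ℝ) (i : Fin N) (q : ℝ × ℝ × ℝ) : ℝ :=
  deriv (fun a => ℓ i (max 0 q.1) a (clampTime T q.2.2)) q.2.1

theorem costExt_of_mem {T : ℝ} (ℓ : Fin N → ℝ → ℝ → ℝ → ℝ) (i : Fin N) {y s : ℝ} (hy : 0 ≤ y)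
    (a : ℝ) (hs : s ∈ Icc 0 T) : costExt T ℓ i (y, a, s) = ℓ i y a s := by
  simp [costExt, clampTime_of_mem hs, hy]

namespace IsRunningCost

variable {p T : ℝ} {ℓ : Fin N → ℝ → ℝ → ℝ → ℝ} {ℓs : ℝ → ℝ}

/-- Clamping position and time makes the cost continuous on the whole space, so that compactness and
measurability arguments need no domain conditions. -/
theorem continuous_costExt (hℓ : IsRunningCost p T ℓ ℓs) (hT : 0 ≤ T) (i : Fin N) :
    Continuous (costExt T ℓ i) := by
  have h := continuous_clampTime T
  refine (hℓ.continuousOn i).comp_continuous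
    (f := fun q : ℝ × ℝ × ℝ => (max 0 q.1, q.2.1, clampTime T q.2.2)) (by fun_prop) ?_
  intro q
  exact ⟨mem_Ici.2 (le_max_left _ _), mem_univ _, clampTime_mem hT _⟩

theorem continuous_slopeExt (hℓ : IsRunningCost p T ℓ ℓs) (hT : 0 ≤ T) (i : Fin N) :
    Continuous (slopeExt T ℓ i) := by
  have h := continuous_clampTime T
  refine (hℓ.continuousOn_deriv_vel i).comp_continuous
    (f := fun q : ℝ × ℝ × ℝ => (max 0 q.1, q.2.1, clampTime T q.2.2)) (by fun_prop) ?_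
  intro q
  exact ⟨mem_Ici.2 (le_max_left _ _), mem_univ _, clampTime_mem hT _⟩

theorem convexOn (hℓ : IsRunningCost p T ℓ ℓs) (i : Fin N) {y : ℝ} (hy : 0 ≤ y) {s : ℝ}
    (hs : s ∈ Icc 0 T) : ConvexOn ℝ univ (fun a => ℓ i y a s) :=
  (hℓ.strictConvex i y hy s hs).convexOn

theorem differentiableAt (hℓ : IsRunningCost p T ℓ ℓs) (i : Fin N) {y : ℝ} (hy : 0 ≤ y) {s : ℝ}
    (hs : s ∈ Icc 0 T) (a : ℝ) : DifferentiableAt ℝ (fun a => ℓ i y a s) a := by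
  have h : DifferentiableOn ℝ (fun a : ℝ => ℓ i y a s) univ :=
    (hℓ.differentiableOn i s hs).comp (f := fun a : ℝ => (y, a)) (by fun_prop)
      (fun a _ => ⟨hy, mem_univ _⟩)
  exact h.differentiableAt univ_mem

theorem tangent_le (hℓ : IsRunningCost p T ℓ ℓs) (i : Fin N) {y : ℝ} (hy : 0 ≤ y) {s : ℝ}
    (hs : s ∈ Icc 0 T) (a b : ℝ) :
    ℓ i y b s + deriv (fun a => ℓ i y a s) b * (a - b) ≤ ℓ i y a s := by
  have hc := hℓ.convexOn i hy hs
  have hd := hℓ.differentiableAt i hy hs b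
  rcases lt_trichotomy a b with h | rfl | h
  · have := hc.slope_le_deriv (mem_univ a) (mem_univ b) h hd
    rw [slope_def_field, div_le_iff₀ (by linarith)] at this
    linarith
  · simp
  · have := hc.deriv_le_slope (mem_univ b) (mem_univ a) h hd
    rw [slope_def_field, le_div_iff₀ (by linarith)] at this
    linarith

/-- Uniform tangent-line lower bounds for the edge costs. -/
theorem exists_uniform_tangent_le (hℓ : IsRunningCost p T ℓ ℓs) (hT : 0 ≤ T) (R M : ℝ) {ε : ℝ}
    (hε : 0 < ε) :
    ∃ η, 0 < η ∧ ∀ i, ∀ y ∈ Icc 0 R, ∀ z ∈ Icc 0 R, |y - z| < η → ∀ b, |b| ≤ M → ∀ a,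
      ∀ s ∈ Icc 0 T, ℓ i z b s + slopeExt T ℓ i (z, b, s) * (a - b) - ε * (1 + |a| + |b|)
        ≤ ℓ i y a s := by
  -- Only (y, b, s) has to range over a compact set: the velocity a enters through the factor a - b
  -- alone, so the bound holds for unbounded a.
  have hQ : IsCompact (Icc 0 R ×ˢ Icc (-M) M ×ˢ Icc 0 T : Set (ℝ × ℝ × ℝ)) :=
    isCompact_Icc.prod (isCompact_Icc.prod isCompact_Icc)
  have huc : ∀ F : ℝ × ℝ × ℝ → ℝ, Continuous F → ∃ η, 0 < η ∧
      ∀ y ∈ Icc 0 R, ∀ z ∈ Icc 0 R, |y - z| < η → ∀ b, |b| ≤ M → ∀ s ∈ Icc 0 T,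
        |F (y, b, s) - F (z, b, s)| ≤ ε := by
    intro F hF
    obtain ⟨η, hη, h⟩ := Metric.uniformContinuousOn_iff.1
      (hQ.uniformContinuousOn_of_continuous hF.continuousOn) ε hε
    refine ⟨η, hη, fun y hy z hz hyz b hb s hs => ?_⟩
    have := h (y, b, s) ⟨hy, abs_le.1 hb, hs⟩ (z, b, s) ⟨hz, abs_le.1 hb, hs⟩
      (by rw [Prod.dist_eq, dist_self, Real.dist_eq]; exact max_lt hyz hη)
    rw [Real.dist_eq] at this
    exact this.le
  choose η₁ hη₁ h₁ using fun i => huc _ (hℓ.continuous_costExt hT i)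
  choose η₂ hη₂ h₂ using fun i => huc _ (hℓ.continuous_slopeExt hT i)
  have hev : ∀ᶠ η : ℝ in 𝓝[>] 0, ∀ i, η < η₁ i ∧ η < η₂ i :=
    eventually_all.2 fun i => nhdsWithin_le_nhds
      ((gt_mem_nhds (hη₁ i)).and (gt_mem_nhds (hη₂ i)))
  obtain ⟨η, hη, hη0⟩ := (hev.and self_mem_nhdsWithin).exists
  refine ⟨η, hη0, fun i y hy z hz hyz b hb a s hs => ?_⟩
  have e1 := h₁ i y hy z hz (hyz.trans (hη i).1) b hb s hs
  have e2 := h₂ i y hy z hz (hyz.trans (hη i).2) b hb s hs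
  rw [costExt_of_mem ℓ i hy.1 _ hs, costExt_of_mem ℓ i hz.1 _ hs] at e1
  have e3 := hℓ.tangent_le i hy.1 hs a b
  have e4 : slopeExt T ℓ i (y, b, s) = deriv (fun a => ℓ i y a s) b := by
    simp [slopeExt, clampTime_of_mem hs, hy.1]
  rw [← e4] at e3
  have e5 : |(slopeExt T ℓ i (y, b, s) - slopeExt T ℓ i (z, b, s)) * (a - b)| ≤
      ε * (|a| + |b|) := by
    rw [abs_mul]
    have := abs_sub a b
    gcongr
  have e6 := (abs_le.1 e5).1
  have e7 := (abs_le.1 e1).1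
  linarith

/-- Below, coercivity suffices. Above, the tangent at a evaluated at 0 gives ℓ(a) ≤ ℓ(0) + ℓ'(a) a,
and the growth of ∂_a ℓ bounds the last term by a multiple of |a|^p + |a|. -/
theorem abs_le_growth (hℓ : IsRunningCost p T ℓ ℓs) (hp : 1 < p) (hT : 0 ≤ T) {R : ℝ}
    (hR : 0 < R) : ∃ C, 0 ≤ C ∧ ∀ i, ∀ y ∈ Icc 0 R, ∀ a, ∀ s ∈ Icc 0 T,
      |ℓ i y a s| ≤ C * (1 + |a| ^ p) := by
  obtain ⟨C₀, hC₀, c₀, hc, -⟩ := hℓ.coercive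
  obtain ⟨c, hc0, hb⟩ := hℓ.deriv_bound R hR
  have hM : ∀ i : Fin N, ∃ M, ∀ q ∈ Icc 0 R ×ˢ ({0} : Set ℝ) ×ˢ Icc 0 T, ‖costExt T ℓ i q‖ ≤ M :=
    fun i => ((isCompact_Icc.prod (isCompact_singleton.prod isCompact_Icc))).exists_bound_of_continuousOn
      (hℓ.continuous_costExt hT i).continuousOn
  choose M hM using hM
  set K := ∑ i, |M i|
  have hK : ∀ i, M i ≤ K := fun i => (le_abs_self _).trans
    (Finset.single_le_sum (f := fun i => |M i|) (fun j _ => abs_nonneg _) (Finset.mem_univ i))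
  have hK0 : 0 ≤ K := Finset.sum_nonneg fun j _ => abs_nonneg _
  refine ⟨K + 2 * c + |c₀|, by positivity, fun i y hy a s hs => ?_⟩
  have hap : 0 ≤ |a| ^ p := by positivity
  have h1 : |a| ^ (p - 1) * |a| = |a| ^ p := by
    rcases eq_or_ne a 0 with rfl | ha
    · simp [Real.zero_rpow (by linarith : p ≠ 0)]
    · rw [← Real.rpow_add_one (by simpa using ha)]; simp
  have h2 : |a| ≤ 1 + |a| ^ p := by
    rcases le_total |a| 1 with h | h
    · linarith
    · have := Real.rpow_le_rpow_of_exponent_le h hp.le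
      rw [Real.rpow_one] at this; linarith
  have hl := hc i y hy.1 a s hs
  have ht := hℓ.tangent_le i hy.1 hs 0 a
  have hd := (hb i y hy a s hs).2
  have h0 : |ℓ i y 0 s| ≤ K := by
    have := hM i (y, 0, s) ⟨hy, rfl, hs⟩
    rw [costExt_of_mem ℓ i hy.1 0 hs, Real.norm_eq_abs] at this
    exact this.trans (hK i)
  have h3 : deriv (fun a => ℓ i y a s) a * a ≤ c * (|a| ^ (p - 1) + 1) * |a| :=
    (le_abs_self _).trans (by rw [abs_mul]; gcongr)
  have h4 : c * (|a| ^ (p - 1) + 1) * |a| = c * (|a| ^ p + |a|) := by rw [← h1]; ring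
  have h5 : c * |a| ≤ c * (1 + |a| ^ p) := by gcongr
  have h6 : 0 ≤ C₀ * |a| ^ p := by positivity
  have h7 := neg_abs_le c₀
  have h8 : 0 ≤ (K + |c₀|) * |a| ^ p := by positivity
  have h9 := abs_nonneg c₀
  have h10 : 0 ≤ c * |a| ^ p := by positivity
  rw [abs_le]
  rw [abs_le] at h0
  constructor <;> nlinarith

theorem vertexCost_le (ℓ : Fin N → ℝ → ℝ → ℝ → ℝ) (ℓs : ℝ → ℝ) (i : Fin N) (s : ℝ) :
    vertexCost ℓ ℓs s ≤ ℓ i 0 0 s :=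
  (min_le_right _ _).trans (ciInf_le (finite_range _).bddBelow i)

theorem continuousOn_vertexCost [NeZero N] (hℓ : IsRunningCost p T ℓ ℓs) :
    ContinuousOn (vertexCost ℓ ℓs) (Icc 0 T) := by
  have h : ∀ i, ContinuousOn (fun s => ℓ i 0 0 s) (Icc 0 T) := fun i =>
    (hℓ.continuousOn i).comp (f := fun s : ℝ => ((0 : ℝ), (0 : ℝ), s)) (by fun_prop)
      (fun s hs => ⟨mem_Ici.2 le_rfl, mem_univ _, hs⟩)
  refine ContinuousOn.inf hℓ.continuousOn_vertex ?_
  have : (fun s => ⨅ i, ℓ i 0 0 s)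
      = fun s => Finset.univ.inf' Finset.univ_nonempty (fun i => ℓ i 0 0 s) := by
    funext s
    rw [Finset.inf'_univ_eq_ciInf]
  rw [this]
  exact ContinuousOn.finset_inf'_apply _ fun i _ => h i

theorem le_vertexCost [NeZero N] {c₀ s : ℝ} (h : ∀ i, c₀ ≤ ℓ i 0 0 s) (hs : c₀ ≤ ℓs s) :
    c₀ ≤ vertexCost ℓ ℓs s :=
  le_min hs (le_ciInf h)

end IsRunningCost

end

section

/-! ### Convex envelopes -/

section Envelope

variable {E : Type*} [AddCommGroup E] [Module ℝ E]

theorem eConvex_coe_iff {f : E → ℝ} :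
    EConvex (fun x => (f x : EReal)) ↔ ConvexOn ℝ univ f := by
  rw [convexOn_iff_convex_epigraph, EConvex]
  simp

/-- The epigraph of a supremum is the intersection of the epigraphs. -/
theorem eConvex_convexEnvelope (F : Set (E → EReal)) : EConvex (convexEnvelope F) := by
  have : {q : E × ℝ | convexEnvelope F q.1 ≤ (q.2 : EReal)} =
      ⋂ g, ⋂ _ : EConvex g ∧ ∀ f ∈ F, g ≤ f, {q : E × ℝ | g q.1 ≤ (q.2 : EReal)} := by
    ext q
    simp [convexEnvelope]
  rw [EConvex, this]
  exact convex_iInter fun g => convex_iInter fun hg => hg.1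

theorem convexEnvelope_le {F : Set (E → EReal)} {f : E → EReal} (hf : f ∈ F) :
    convexEnvelope F ≤ f :=
  fun x => iSup₂_le fun _ hg => hg.2 f hf x

theorem le_convexEnvelope {F : Set (E → EReal)} {g : E → EReal} (hg : EConvex g)
    (h : ∀ f ∈ F, g ≤ f) : g ≤ convexEnvelope F :=
  fun x => le_iSup₂ (f := fun (g : E → EReal)
    (_ : g ∈ {g : E → EReal | EConvex g ∧ ∀ f ∈ F, g ≤ f}) => g x) g ⟨hg, h⟩

end Envelope

variable {N : ℕ} {p T : ℝ} {ℓ : Fin N → ℝ → ℝ → ℝ → ℝ} {ℓs : ℝ → ℝ}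

/-! ### The vertex envelope: finiteness, value at zero, regularity in velocity and time -/

/-- Lower bounds on ℒ_0 go through this competitor principle. At b = 0 the condition is on ℓ_0
alone, since ℓ_0 ≤ min_i ℓ_i(0, 0, ·). -/
theorem coe_le_vertexEnvelope {f : Space N → ℝ} (hf : ConvexOn ℝ univ f) {s : ℝ}
    (h : ∀ i, ∀ b ∈ axisLine i, f b ≤ ℓ i 0 (b i) s) (h0 : f 0 ≤ vertexCost ℓ ℓs s)
    (a : Space N) : (f a : EReal) ≤ vertexEnvelope ℓ ℓs a s := by
  refine le_convexEnvelope (g := fun a => (f a : EReal)) (eConvex_coe_iff.2 hf) ?_ a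
  rintro g (rfl | rfl) b
  · change (f b : EReal) ≤ ellExt ℓ 0 b s
    unfold ellExt
    split_ifs with hb
    · rw [hb.2, EReal.coe_le_coe_iff]
      exact h0.trans (min_le_right _ _)
    · refine le_iInf₂ fun i hi => ?_
      rw [EReal.coe_le_coe_iff]
      exact h i b hi.2
  · rcases eq_or_ne b 0 with rfl | hb
    · simpa [chiZero] using h0
    · simp [chiZero, hb]

theorem vertexEnvelope_le_of_mem_axisLine {i : Fin N} {b : Space N} (hb : b ∈ axisLine i) (s : ℝ) :
    vertexEnvelope ℓ ℓs b s ≤ (ℓ i 0 (b i) s : EReal) := by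
  refine (convexEnvelope_le (f := fun b => ellExt ℓ 0 b s) (by simp) b).trans ?_
  change ellExt ℓ 0 b s ≤ _
  unfold ellExt
  split_ifs with h
  · rw [h.2, EReal.coe_le_coe_iff]
    exact ciInf_le (finite_range _).bddBelow i
  · exact iInf₂_le (f := fun (i : Fin N) (_ : (0 : Space N) ∈ edge i ∧ b ∈ axisLine i) =>
      (ℓ i 0 (b i) s : EReal)) i ⟨zero_mem_edge i, hb⟩

theorem vertexEnvelope_zero_le (s : ℝ) :
    vertexEnvelope ℓ ℓs (0 : Space N) s ≤ (vertexCost ℓ ℓs s : EReal) := by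
  refine (convexEnvelope_le
    (f := fun b => (vertexCost ℓ ℓs s : EReal) + chiZero b) (by simp) 0).trans ?_
  simp [chiZero]

theorem eConvex_vertexEnvelope (s : ℝ) :
    EConvex (fun a : Space N => vertexEnvelope ℓ ℓs a s) :=
  eConvex_convexEnvelope _

namespace IsRunningCost

/-- Its slope along e_i is that of the tangent to ℓ_i(0, ·, s) at 0, and its constant term is ℓ_0 ≤
ℓ_i(0, 0, s), so on each axis it lies below the tangent line. It equals ℓ_0 at the origin, which
pins down ℒ_0(0, s). -/
theorem affine_le_vertexEnvelope (hℓ : IsRunningCost p T ℓ ℓs) {s : ℝ} (hs : s ∈ Icc 0 T)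
    (a : Space N) :
    ((vertexCost ℓ ℓs s + ∑ i, deriv (fun b => ℓ i 0 b s) 0 * a i : ℝ) : EReal)
      ≤ vertexEnvelope ℓ ℓs a s := by
  refine coe_le_vertexEnvelope
    (f := fun a => vertexCost ℓ ℓs s + ∑ i, deriv (fun b => ℓ i 0 b s) 0 * a i) ?_ ?_ ?_ a
  · refine ⟨convex_univ, fun x _ y _ u v _ _ huv => le_of_eq ?_⟩
    have : v = 1 - u := by linarith
    subst this
    simp only [PiLp.add_apply, PiLp.smul_apply, smul_eq_mul, mul_add, Finset.mul_sum]
    rw [Finset.sum_add_distrib]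
    have h1 : ∀ (w : ℝ) (x : Space N), ∑ i, deriv (fun b => ℓ i 0 b s) 0 * (w * x i)
        = ∑ i, w * (deriv (fun b => ℓ i 0 b s) 0 * x i) :=
      fun w x => Finset.sum_congr rfl fun i _ => by ring
    rw [h1, h1]
    ring
  · intro i b hb
    rw [Finset.sum_eq_single i]
    · have h1 := hℓ.tangent_le i le_rfl hs (b i) 0
      have h2 := vertexCost_le ℓ ℓs i s
      rw [sub_zero] at h1
      linarith
    · intro j _ hj
      simp [mem_axisLine_iff.1 hb j hj]
    · simp
  · simp

theorem vertexEnvelope_zero (hℓ : IsRunningCost p T ℓ ℓs) {s : ℝ} (hs : s ∈ Icc 0 T) :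
    vertexEnvelope ℓ ℓs (0 : Space N) s = (vertexCost ℓ ℓs s : EReal) := by
  refine le_antisymm (vertexEnvelope_zero_le s) ?_
  simpa using hℓ.affine_le_vertexEnvelope hs 0

theorem vertexEnvelope_ne_bot (hℓ : IsRunningCost p T ℓ ℓs) {s : ℝ} (hs : s ∈ Icc 0 T)
    (a : Space N) : vertexEnvelope ℓ ℓs a s ≠ ⊥ :=
  ((EReal.bot_lt_coe _).trans_le (hℓ.affine_le_vertexEnvelope hs a)).ne'

end IsRunningCost

/-- Jensen's inequality for a = (1/N) ∑ (N a_i) e_i: the envelope is at most the finite edge cost at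
each of these points of the axes. -/
theorem vertexEnvelope_ne_top [NeZero N] (a : Space N) (s : ℝ) :
    vertexEnvelope ℓ ℓs a s ≠ ⊤ := by
  have hN : (N : ℝ) ≠ 0 := Nat.cast_ne_zero.2 (NeZero.ne N)
  have h := (eConvex_vertexEnvelope (ℓ := ℓ) (ℓs := ℓs) s).sum_mem (t := Finset.univ)
    (w := fun _ : Fin N => (N : ℝ)⁻¹)
    (z := fun i => ((N * a i) • EuclideanSpace.single i (1 : ℝ), ℓ i 0 (N * a i) s))
    (fun _ _ => by positivity) (by simp [hN]) (fun i _ => by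
      have := vertexEnvelope_le_of_mem_axisLine (ℓ := ℓ) (ℓs := ℓs)
        (b := (N * a i) • EuclideanSpace.single i (1 : ℝ)) ⟨_, rfl⟩ s
      simpa using this)
  have hfst : (∑ i : Fin N, (N : ℝ)⁻¹ • ((N * a i) • EuclideanSpace.single i (1 : ℝ),
      ℓ i 0 (N * a i) s)).1 = a := by
    ext j
    simp [Prod.fst_sum, Finset.sum_apply, hN, Finset.sum_ite_eq, Pi.single_apply]
  rw [mem_ofPred_eq, hfst] at h
  exact (h.trans_lt (EReal.coe_lt_top _)).ne

/-- The real-valued function underlying `ℒ_0`. -/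
noncomputable def vertexEnvelopeReal (ℓ : Fin N → ℝ → ℝ → ℝ → ℝ) (ℓs : ℝ → ℝ) (a : Space N)
    (s : ℝ) : ℝ :=
  (vertexEnvelope ℓ ℓs a s).toReal

namespace IsRunningCost

variable [NeZero N]

theorem coe_vertexEnvelopeReal (hℓ : IsRunningCost p T ℓ ℓs) {s : ℝ} (hs : s ∈ Icc 0 T)
    (a : Space N) : (vertexEnvelopeReal ℓ ℓs a s : EReal) = vertexEnvelope ℓ ℓs a s :=
  EReal.coe_toReal (vertexEnvelope_ne_top a s) (hℓ.vertexEnvelope_ne_bot hs a)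

theorem convexOn_vertexEnvelopeReal (hℓ : IsRunningCost p T ℓ ℓs) {s : ℝ} (hs : s ∈ Icc 0 T) :
    ConvexOn ℝ univ (fun a => vertexEnvelopeReal ℓ ℓs a s) := by
  rw [← eConvex_coe_iff]
  simp_rw [hℓ.coe_vertexEnvelopeReal hs]
  exact eConvex_vertexEnvelope s

theorem continuous_vertexEnvelopeReal (hℓ : IsRunningCost p T ℓ ℓs) {s : ℝ} (hs : s ∈ Icc 0 T) :
    Continuous (fun a => vertexEnvelopeReal ℓ ℓs a s) := by
  rw [← continuousOn_univ]
  exact (hℓ.convexOn_vertexEnvelopeReal hs).continuousOn isOpen_univ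

/-- An approximate comparison of `ℒ_0` at two times. -/
theorem vertexEnvelopeReal_le_of_close (hℓ : IsRunningCost p T ℓ ℓs) {s s' : ℝ}
    (hs : s ∈ Icc 0 T) (hs' : s' ∈ Icc 0 T) {κ ε : ℝ} (hκ : κ ≤ 1)
    (h : ∀ i b, (1 - κ) * ℓ i 0 b s - ε ≤ ℓ i 0 b s')
    (h0 : (1 - κ) * vertexCost ℓ ℓs s - ε ≤ vertexCost ℓ ℓs s') (a : Space N) :
    (1 - κ) * vertexEnvelopeReal ℓ ℓs a s - ε ≤ vertexEnvelopeReal ℓ ℓs a s' := by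
  have hκ' : 0 ≤ 1 - κ := by linarith
  rw [← EReal.coe_le_coe_iff, hℓ.coe_vertexEnvelopeReal hs']
  -- As 1 - κ ≥ 0, the function (1 - κ) ℒ_0(·, s) - ε is convex, hence a competitor at time s'.
  refine coe_le_vertexEnvelope
    (f := fun a => (1 - κ) * vertexEnvelopeReal ℓ ℓs a s - ε) ?_ ?_ ?_ a
  · exact ((hℓ.convexOn_vertexEnvelopeReal hs).smul hκ').add_const (-ε)
  · intro i b hb
    refine le_trans ?_ (h i (b i))
    have : vertexEnvelopeReal ℓ ℓs b s ≤ ℓ i 0 (b i) s := by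
      rw [← EReal.coe_le_coe_iff, hℓ.coe_vertexEnvelopeReal hs]
      exact vertexEnvelope_le_of_mem_axisLine hb s
    gcongr
  · refine le_trans ?_ h0
    have : vertexEnvelopeReal ℓ ℓs (0 : Space N) s ≤ vertexCost ℓ ℓs s := by
      rw [← EReal.coe_le_coe_iff, hℓ.coe_vertexEnvelopeReal hs]
      exact vertexEnvelope_zero_le s
    gcongr

theorem lowerSemicontinuousOn_vertexEnvelopeReal (hℓ : IsRunningCost p T ℓ ℓs) (a : Space N) :
    LowerSemicontinuousOn (fun s => vertexEnvelopeReal ℓ ℓs a s) (Icc 0 T) := by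
  intro s hs y hy
  obtain ⟨C₀, hC₀, c₀, hc, -⟩ := hℓ.coercive
  obtain ⟨m, hm, hmod⟩ := hℓ.modulus 1 one_pos
  have hm0 : ∀ r, 0 ≤ r → 0 ≤ m r := fun r hr => by
    have := hm.mono (mem_Ici.2 le_rfl) (mem_Ici.2 hr) hr
    rwa [hm.zero] at this
  have hmt : Tendsto (fun s' => m |s - s'|) (𝓝[Icc 0 T] s) (𝓝 0) := by
    have h1 : Tendsto (fun s' => |s - s'|) (𝓝[Icc 0 T] s) (𝓝[Ici 0] 0) := by
      refine tendsto_nhdsWithin_iff.2 ⟨?_, Eventually.of_forall fun _ => mem_Ici.2 (abs_nonneg _)⟩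
      have : ContinuousAt (fun s' : ℝ => |s - s'|) s := by fun_prop
      simpa [ContinuousAt] using this.tendsto.mono_left (nhdsWithin_le_nhds (s := Icc 0 T))
    have h2 := hm.cont.tendsto
    rw [hm.zero] at h2
    exact h2.comp h1
  have hv : Tendsto (fun s' => |vertexCost ℓ ℓs s' - vertexCost ℓ ℓs s|) (𝓝[Icc 0 T] s) (𝓝 0) := by
    have := (hℓ.continuousOn_vertexCost s hs).tendsto.sub_const (vertexCost ℓ ℓs s)
    simpa using this.abs
  -- The time error m (1 + |b|^p) is not uniform in b. Coercivity gives m |b|^p ≤ κ (ℓ_i(0, b, s) -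
  -- c₀) with κ = m / C₀, so the growing part becomes a relative error κ, and ε collects the bounded
  -- remainders for the edges and the vertex.
  set κ : ℝ → ℝ := fun s' => m |s - s'| / C₀
  set ε : ℝ → ℝ := fun s' => m |s - s'| + κ s' * |c₀| + κ s' * |vertexCost ℓ ℓs s|
    + |vertexCost ℓ ℓs s' - vertexCost ℓ ℓs s|
  have hκt : Tendsto κ (𝓝[Icc 0 T] s) (𝓝 0) := by simpa using hmt.div_const C₀
  have hεt : Tendsto ε (𝓝[Icc 0 T] s) (𝓝 0) := by
    simpa using ((hmt.add (hκt.mul_const |c₀|)).add (hκt.mul_const |vertexCost ℓ ℓs s|)).add hv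
  have hlim : Tendsto (fun s' => (1 - κ s') * vertexEnvelopeReal ℓ ℓs a s - ε s') (𝓝[Icc 0 T] s)
      (𝓝 (vertexEnvelopeReal ℓ ℓs a s)) := by
    simpa using ((hκt.const_sub 1).mul_const (vertexEnvelopeReal ℓ ℓs a s)).sub hεt
  filter_upwards [hlim.eventually (lt_mem_nhds hy), hκt.eventually (gt_mem_nhds one_pos),
    self_mem_nhdsWithin] with s' h1 h2 hs'
  refine h1.trans_le (hℓ.vertexEnvelopeReal_le_of_close hs hs' h2.le ?_ ?_ a)
  · intro i b
    have hms := hm0 |s - s'| (abs_nonneg _)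
    have e1 := (abs_le.1 (hmod i 0 ⟨le_rfl, zero_le_one⟩ b s hs s' hs')).2
    have e2 := hc i 0 le_rfl b s hs
    have hκ0 : 0 ≤ κ s' := by positivity
    have e3 : m |s - s'| = κ s' * C₀ := by simp only [κ]; field_simp
    have e4 : κ s' * (C₀ * |b| ^ p + c₀) ≤ κ s' * ℓ i 0 b s := by gcongr
    have e5 : κ s' * -|c₀| ≤ κ s' * c₀ := by gcongr; exact neg_abs_le c₀
    have e6 : 0 ≤ κ s' * |vertexCost ℓ ℓs s| := by positivity
    have e7 := abs_nonneg (vertexCost ℓ ℓs s' - vertexCost ℓ ℓs s)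
    have e8 : m |s - s'| * |b| ^ p = κ s' * (C₀ * |b| ^ p) := by rw [e3]; ring
    simp only [ε]
    nlinarith
  · have hms := hm0 |s - s'| (abs_nonneg _)
    have hκ0 : 0 ≤ κ s' := by positivity
    have e1 : κ s' * -|vertexCost ℓ ℓs s| ≤ κ s' * vertexCost ℓ ℓs s := by
      gcongr; exact neg_abs_le _
    have e2 := neg_abs_le (vertexCost ℓ ℓs s' - vertexCost ℓ ℓs s)
    have e3 : 0 ≤ κ s' * |c₀| := by positivity
    simp only [ε]
    nlinarith

end IsRunningCost

end

section

variable {N : ℕ} {p T : ℝ} {ℓ : Fin N → ℝ → ℝ → ℝ → ℝ} {ℓs : ℝ → ℝ}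

/-! ### The extended integrand -/

theorem ellExt_of_mem_edge {i : Fin N} {z : Space N} (hz : z ∈ edge i) (h0 : z ≠ 0) {a : Space N}
    (ha : a ∈ axisLine i) (s : ℝ) : ellExt ℓ z a s = (ℓ i (z i) (a i) s : EReal) := by
  rw [ellExt, if_neg fun h => h0 h.1]
  refine le_antisymm (iInf₂_le (f := fun (i : Fin N) (_ : z ∈ edge i ∧ a ∈ axisLine i) =>
      (ℓ i (z i) (a i) s : EReal)) i ⟨hz, ha⟩) (le_iInf₂ fun j hj => ?_)
  rw [edge_index_unique hz hj.1 h0]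

theorem phi_of_mem_edge {i : Fin N} {z : Space N} (hz : z ∈ edge i) (h0 : z ≠ 0) {a : Space N}
    (ha : a ∈ axisLine i) (s : ℝ) : phi ℓ ℓs z a s = (ℓ i (z i) (a i) s : EReal) := by
  rw [phi, if_neg h0, ellExt_of_mem_edge hz h0 ha]

open Classical in
/-- The extended integrand as a finite infimum of functions supported on closed sets. -/
theorem phi_eq_inf (z a : Space N) (s : ℝ) :
    phi ℓ ℓs z a s = (if z = 0 then vertexEnvelope ℓ ℓs a s else ⊤) ⊓
      ⨅ i, if z ∈ edge i ∧ a ∈ axisLine i then (ℓ i (z i) (a i) s : EReal) else ⊤ := by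
  unfold phi
  split_ifs with hz
  -- At the vertex the edge terms do not lower the infimum, because ℒ_0 is below every edge cost on
  -- its axis. Hence the edge terms may be supported on the closed edges, vertex included.
  · refine (inf_eq_left.2 (le_iInf fun i => ?_)).symm
    split_ifs with hi
    · rw [hz]
      exact vertexEnvelope_le_of_mem_axisLine hi.2 s
    · exact le_top
  · rw [top_inf_eq, ellExt, if_neg fun h => hz h.1]
    refine iInf_congr fun i => ?_
    by_cases hi : z ∈ edge i ∧ a ∈ axisLine i <;> simp [hi]

/-- Off the closed set the value is ⊤ on a whole neighbourhood; on it, nearby values are close to f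
or jump up. -/
theorem lowerSemicontinuous_ite_top {X : Type*} [TopologicalSpace X] {S : Set X}
    [DecidablePred (· ∈ S)] (hS : IsClosed S) {f : X → ℝ} (hf : Continuous f) :
    LowerSemicontinuous fun x => if x ∈ S then (f x : EReal) else ⊤ := by
  intro x y hy
  by_cases hx : x ∈ S
  · simp only [hx, if_true] at hy
    have := (continuous_coe_real_ereal.comp hf).tendsto x |>.eventually (lt_mem_nhds hy)
    filter_upwards [this] with x' hx'
    split_ifs
    · exact hx'
    · exact hy.trans_le le_top
  · filter_upwards [hS.isOpen_compl.mem_nhds hx] with x' hx'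
    rw [if_neg hx']
    simpa [hx] using hy

theorem lowerSemicontinuous_iInf_of_finite {X ι : Type*} [TopologicalSpace X] [Finite ι]
    {f : ι → X → EReal} (hf : ∀ i, LowerSemicontinuous (f i)) :
    LowerSemicontinuous fun x => ⨅ i, f i x := by
  intro x y hy
  have h : ∀ᶠ x' in 𝓝 x, ∀ i, y < f i x' :=
    eventually_all.2 fun i => hf i x y (hy.trans_le (iInf_le _ i))
  filter_upwards [h] with x' hx'
  rcases isEmpty_or_nonempty ι with hι | hι
  · simpa [iInf_of_empty] using hy
  · obtain ⟨i, hi⟩ := exists_eq_ciInf_of_finite (f := fun i => f i x')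
    rw [← hi]
    exact hx' i

namespace IsRunningCost

theorem lowerSemicontinuous_phi [NeZero N] (hℓ : IsRunningCost p T ℓ ℓs) (hT : 0 ≤ T) {s : ℝ}
    (hs : s ∈ Icc 0 T) :
    LowerSemicontinuous (fun q : Space N × Space N => phi ℓ ℓs q.1 q.2 s) := by
  classical
  simp_rw [phi_eq_inf, ← hℓ.coe_vertexEnvelopeReal hs]
  refine LowerSemicontinuous.inf ?_ (lowerSemicontinuous_iInf_of_finite fun i => ?_)
  · exact lowerSemicontinuous_ite_top (S := {q : Space N × Space N | q.1 = 0})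
      (isClosed_eq continuous_fst continuous_const)
      ((hℓ.continuous_vertexEnvelopeReal hs).comp continuous_snd)
  · have hc : Continuous fun q : Space N × Space N => costExt T ℓ i (q.1 i, q.2 i, s) :=
      (hℓ.continuous_costExt hT i).comp (by fun_prop)
    convert lowerSemicontinuous_ite_top (S := {q : Space N × Space N | q.1 ∈ edge i ∧ q.2 ∈ axisLine i})
      (((isClosed_edge i).preimage continuous_fst).inter
        ((isClosed_axisLine i).preimage continuous_snd)) hc using 2 with q
    simp only [mem_ofPred_eq]
    split_ifs with h
    · rw [costExt_of_mem ℓ i (mem_edge_iff.1 h.1).1 _ hs]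
    · rfl

theorem phi_ne_bot (hℓ : IsRunningCost p T ℓ ℓs) (z a : Space N) {s : ℝ} (hs : s ∈ Icc 0 T) :
    phi ℓ ℓs z a s ≠ ⊥ := by
  by_cases hz : z = 0
  · rw [phi, if_pos hz]
    exact hℓ.vertexEnvelope_ne_bot hs a
  obtain ⟨C₀, hC₀, c₀, hc, -⟩ := hℓ.coercive
  rw [phi, if_neg hz, ellExt, if_neg fun h => hz h.1]
  refine ((EReal.bot_lt_coe c₀).trans_le (le_iInf₂ fun i hi => ?_)).ne'
  rw [EReal.coe_le_coe_iff]
  have := hc i (z i) (mem_edge_iff.1 hi.1).1 (a i) s hs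
  have h1 : 0 ≤ C₀ * |a i| ^ p := by positivity
  linarith

theorem eConvex_phi (hℓ : IsRunningCost p T ℓ ℓs) (z : Space N) {s : ℝ} (hs : s ∈ Icc 0 T) :
    EConvex (fun a : Space N => phi ℓ ℓs z a s) := by
  by_cases hz : z = 0
  · simp only [phi, if_pos hz]
    exact eConvex_vertexEnvelope s
  by_cases hzi : ∃ i, z ∈ edge i
  · obtain ⟨i, hi⟩ := hzi
    have hset : {q : Space N × ℝ | phi ℓ ℓs z q.1 s ≤ (q.2 : EReal)} =
        {q : Space N × ℝ | q.1 ∈ axisLine i ∧ ℓ i (z i) (q.1 i) s ≤ q.2} := by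
      ext ⟨a, r⟩
      by_cases ha : a ∈ axisLine i
      · simp [phi_of_mem_edge hi hz ha, ha]
      · have : phi ℓ ℓs z a s = ⊤ := by
          rw [phi, if_neg hz, ellExt, if_neg fun h => hz h.1, iInf₂_eq_top]
          intro j hj
          rw [edge_index_unique hi hj.1 hz] at hj
          exact absurd hj.2 ha
        simp [this, ha]
    rw [EConvex, hset]
    rintro ⟨a, r⟩ ⟨ha, hr⟩ ⟨b, r'⟩ ⟨hb, hr'⟩ u v hu hv huv
    refine ⟨convex_axisLine i ha hb hu hv huv, ?_⟩
    have h := (hℓ.convexOn i (mem_edge_iff.1 hi).1 hs).2 (mem_univ (a i)) (mem_univ (b i)) hu hv huv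
    simp only [smul_eq_mul] at h hr hr' ⊢
    refine h.trans ?_
    change _ ≤ u * r + v * r'
    gcongr
  · push Not at hzi
    have hset : {q : Space N × ℝ | phi ℓ ℓs z q.1 s ≤ (q.2 : EReal)} = ∅ := by
      ext ⟨a, r⟩
      have : phi ℓ ℓs z a s = ⊤ := by
        rw [phi, if_neg hz, ellExt, if_neg fun h => hz h.1, iInf₂_eq_top]
        intro j hj
        exact absurd hj.1 (hzi j)
      simp [this]
    rw [EConvex, hset]
    exact convex_empty

end IsRunningCost

/-! ### Measurability -/

theorem borel_le_lebesgueSigma (T : ℝ) :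
    (inferInstance : MeasurableSpace (Icc (0 : ℝ) T)) ≤ lebesgueSigma T :=
  fun _ hs => MeasurableSet.nullMeasurableSet hs

namespace IsRunningCost

variable [NeZero N]

/-- A Carathéodory function: continuous in a, measurable in s by semicontinuity. -/
theorem measurable_vertexEnvelopeReal (hℓ : IsRunningCost p T ℓ ℓs) :
    Measurable (fun q : Space N × Icc (0 : ℝ) T => vertexEnvelopeReal ℓ ℓs q.1 (q.2 : ℝ)) :=
  measurable_uncurry_of_continuous_of_measurable
    (u := fun (a : Space N) (s : Icc (0 : ℝ) T) => vertexEnvelopeReal ℓ ℓs a (s : ℝ))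
    (fun s => hℓ.continuous_vertexEnvelopeReal s.2)
    (fun a => LowerSemicontinuous.measurable
      (lowerSemicontinuous_restrict_iff.2 (hℓ.lowerSemicontinuousOn_vertexEnvelopeReal a)))

theorem measurable_vertexEnvelope (hℓ : IsRunningCost p T ℓ ℓs) :
    Measurable (fun q : Space N × Icc (0 : ℝ) T => vertexEnvelope ℓ ℓs q.1 (q.2 : ℝ)) := by
  have : (fun q : Space N × Icc (0 : ℝ) T => vertexEnvelope ℓ ℓs q.1 (q.2 : ℝ)) =
      fun q => (vertexEnvelopeReal ℓ ℓs q.1 (q.2 : ℝ) : EReal) := by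
    funext q
    rw [hℓ.coe_vertexEnvelopeReal q.2.2]
  rw [this]
  exact measurable_coe_real_ereal.comp hℓ.measurable_vertexEnvelopeReal

theorem measurable_phi (hℓ : IsRunningCost p T ℓ ℓs) (hT : 0 ≤ T) :
    Measurable (fun q : Space N × Space N × Icc (0 : ℝ) T => phi ℓ ℓs q.1 q.2.1 (q.2.2 : ℝ)) := by
  classical
  simp_rw [phi_eq_inf]
  refine Measurable.inf ?_ (Measurable.iInf fun i => ?_)
  · exact Measurable.ite (measurable_fst (measurableSet_singleton 0))
      (hℓ.measurable_vertexEnvelope.comp measurable_snd) measurable_const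
  · have hS : MeasurableSet {q : Space N × Space N × Icc (0 : ℝ) T |
        q.1 ∈ edge i ∧ q.2.1 ∈ axisLine i} :=
      (measurable_fst (isClosed_edge i).measurableSet).inter
        ((measurable_fst.comp measurable_snd) (isClosed_axisLine i).measurableSet)
    have hc : Measurable fun q : Space N × Space N × Icc (0 : ℝ) T =>
        costExt T ℓ i (q.1 i, q.2.1 i, (q.2.2 : ℝ)) :=
      ((hℓ.continuous_costExt hT i).comp (by fun_prop)).measurable
    have h := @Measurable.ite _ _ _ _ _ _ _ (Classical.decPred _) hS
      (measurable_coe_real_ereal.comp hc) (measurable_const (a := ⊤))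
    convert h using 2 with q
    · split_ifs with h
      · simp [costExt_of_mem ℓ i (mem_edge_iff.1 h.1).1 _ q.2.2.2]
      · rfl

end IsRunningCost

end

section

/-! ### Absolutely continuous functions of one variable -/

theorem intervalIntegrable_of_integrableOn_Ioo {v : ℝ → ℝ} {t T : ℝ} (htT : t ≤ T)
    (hv : IntegrableOn v (Ioo t T)) : IntervalIntegrable v volume t T :=
  (intervalIntegrable_iff_integrableOn_Ioo_of_le htT).2 hv

theorem intervalIntegral_eq_setIntegral_Ioo {v : ℝ → ℝ} {t T : ℝ} (htT : t ≤ T) :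
    ∫ s in t..T, v s = ∫ s in Ioo t T, v s := by
  rw [intervalIntegral.integral_of_le htT, restrict_Ioo_eq_restrict_Ioc]

theorem continuousOn_primitive_of_integrableOn_Ioo {v : ℝ → ℝ} {t T : ℝ} (htT : t ≤ T)
    (hv : IntegrableOn v (Ioo t T)) : ContinuousOn (fun s => ∫ r in t..s, v r) (Icc t T) := by
  have := intervalIntegral.continuousOn_primitive_interval' (a := t)
    (intervalIntegrable_of_integrableOn_Ioo htT hv) left_mem_uIcc
  rwa [uIcc_of_le htT] at this

/-- Integration by parts against a primitive of an integrable function. -/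
theorem setIntegral_deriv_mul_primitive {v : ℝ → ℝ} {t T : ℝ} (htT : t ≤ T)
    (hv : IntegrableOn v (Ioo t T)) {η : ℝ → ℝ} (hη : ContDiff ℝ 1 η) :
    ∫ s in Ioo t T, deriv η s * ∫ r in t..s, v r =
      η T * (∫ s in Ioo t T, v s) - ∫ s in Ioo t T, η s * v s := by
  have hi := intervalIntegrable_of_integrableOn_Ioo htT hv
  have hV := hi.absolutelyContinuousOnInterval_intervalIntegral (c := t) left_mem_uIcc
  have hηa : AbsolutelyContinuousOnInterval η t T := hη.contDiffOn.absolutelyContinuousOnInterval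
  have h := hV.integral_mul_deriv_eq_deriv_mul hηa
  have hd : ∫ x in t..T, deriv (fun x => ∫ r in t..x, v r) x * η x = ∫ x in t..T, η x * v x := by
    refine intervalIntegral.integral_congr_ae ?_
    filter_upwards [hi.ae_hasDerivAt_integral] with x hx hxm
    rw [(hx (uIoc_subset_uIcc hxm) t left_mem_uIcc).deriv, mul_comm]
  rw [hd, intervalIntegral_eq_setIntegral_Ioo htT, intervalIntegral_eq_setIntegral_Ioo htT,
    intervalIntegral_eq_setIntegral_Ioo htT] at h
  simp only [intervalIntegral.integral_same, zero_mul, sub_zero] at h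
  rw [mul_comm (η T), ← h]
  exact integral_congr_ae (Eventually.of_forall fun s => mul_comm _ _)

/-- A test function with zero mean has a primitive which is a test function. -/
theorem exists_testFunction_deriv_eq {t T : ℝ} {θ : ℝ → ℝ} (hθ : ContDiff ℝ ∞ θ)
    (hc : HasCompactSupport θ) (hs : tsupport θ ⊆ Ioo t T) (h0 : ∫ s, θ s = 0) :
    ∃ η : ℝ → ℝ, ContDiff ℝ ∞ η ∧ HasCompactSupport η ∧ tsupport η ⊆ Ioo t T ∧ deriv η = θ := by
  -- A margin δ around the support keeps the primitive supported in a compact subinterval of (t, T).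
  obtain ⟨δ, hδ, hsub⟩ := hc.isCompact.exists_cthickening_subset_open isOpen_Ioo hs
  have key : ∀ x, θ x ≠ 0 → t + δ < x ∧ x < T - δ := by
    intro x hx
    have hx' := subset_tsupport θ hx
    have h1 := hsub (Metric.mem_cthickening_of_dist_le (x - δ) x δ _ hx' (by simp [abs_of_pos hδ]))
    have h2 := hsub (Metric.mem_cthickening_of_dist_le (x + δ) x δ _ hx' (by simp [abs_of_pos hδ]))
    exact ⟨by linarith [h1.1], by linarith [h2.2]⟩
  have hd : deriv (fun s => ∫ r in t..s, θ r) = θ := by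
    funext s
    exact hθ.continuous.deriv_integral θ t s
  have hzero : ∀ s, s ∉ Icc (t + δ) (T - δ) → ∫ r in t..s, θ r = 0 := by
    intro s hsm
    by_cases h : s < t + δ
    · refine intervalIntegral.integral_zero_ae (Eventually.of_forall fun r hr => ?_)
      by_contra hne
      have := (key r hne).1
      rcases le_total t s with h' | h'
      · rw [uIoc_of_le h'] at hr
        linarith [hr.2]
      · rw [uIoc_of_ge h'] at hr
        linarith [hr.2]
    -- Beyond T - δ the integral already covers the whole support of θ, so it is the zero mean.
    · rw [intervalIntegral.integral_eq_integral_of_support_subset, h0]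
      intro r hr
      have h1 := key r hr
      have h2 : T - δ < s := by
        by_contra h2
        exact hsm ⟨not_lt.1 h, not_lt.1 h2⟩
      exact ⟨by linarith, by linarith⟩
  have hts : tsupport (fun s => ∫ r in t..s, θ r) ⊆ Icc (t + δ) (T - δ) := by
    refine closure_minimal (fun s hs' => ?_) isClosed_Icc
    by_contra h
    exact hs' (hzero s h)
  refine ⟨fun s => ∫ r in t..s, θ r, ?_, ?_, ?_, hd⟩
  · rw [contDiff_infty_iff_deriv, hd]
    exact ⟨fun s => (intervalIntegral.integral_hasDerivAt_right
      (hθ.continuous.intervalIntegrable _ _) (hθ.continuous.stronglyMeasurableAtFilter _ _)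
      hθ.continuous.continuousAt).differentiableAt, hθ⟩
  · exact isCompact_Icc.of_isClosed_subset (isClosed_tsupport _) hts
  · exact hts.trans fun s hs' => ⟨by linarith [hs'.1], by linarith [hs'.2]⟩

/-- A function with an integrable weak derivative is a.e. equal to a primitive of it. -/
theorem ae_eq_const_add_primitive {t T : ℝ} (htT : t < T) {u v : ℝ → ℝ}
    (hu : IntegrableOn u (Ioo t T)) (hv : IntegrableOn v (Ioo t T))
    (h : ∀ η : ℝ → ℝ, ContDiff ℝ ∞ η → HasCompactSupport η → tsupport η ⊆ Ioo t T →
      ∫ s in Ioo t T, deriv η s * u s = - ∫ s in Ioo t T, η s * v s) :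
    ∃ c : ℝ, u =ᵐ[intervalMeasure t T] fun s => c + ∫ r in t..s, v r := by
  have hVc := continuousOn_primitive_of_integrableOn_Ioo htT.le hv
  have hV : IntegrableOn (fun s => ∫ r in t..s, v r) (Ioo t T) :=
    (hVc.integrableOn_compact isCompact_Icc).mono_set Ioo_subset_Icc_self
  set w : ℝ → ℝ := fun s => u s - ∫ r in t..s, v r with hw
  have hwi : IntegrableOn w (Ioo t T) := hu.sub hV
  have hmul : ∀ {θ f : ℝ → ℝ}, Continuous θ → HasCompactSupport θ → IntegrableOn f (Ioo t T) →
      IntegrableOn (fun s => θ s * f s) (Ioo t T) := by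
    intro θ f hθ hc hf
    obtain ⟨C, hC⟩ := hc.exists_bound_of_continuous hθ
    exact hf.bdd_mul hθ.aestronglyMeasurable (Eventually.of_forall hC)
  have hzero : ∀ η : ℝ → ℝ, ContDiff ℝ ∞ η → HasCompactSupport η → tsupport η ⊆ Ioo t T →
      ∫ s in Ioo t T, deriv η s * w s = 0 := by
    intro η h1 h2 h3
    have hd : Continuous (deriv η) := h1.continuous_deriv (by simp)
    have hηT : η T = 0 := image_eq_zero_of_notMem_tsupport fun hT => (h3 hT).2.false
    have e := setIntegral_deriv_mul_primitive htT.le hv (h1.of_le (by simp) : ContDiff ℝ 1 η)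
    rw [hηT, zero_mul, zero_sub] at e
    simp only [hw, mul_sub]
    rw [integral_sub (hmul hd h2.deriv hu) (hmul hd h2.deriv hV), h η h1 h2 h3, e, sub_self]
  -- Du Bois-Reymond: w has zero weak derivative. The normalized bump ψ₀ has integral one;
  -- subtracting (∫ψ) ψ₀ from a test function ψ leaves zero mean, hence the derivative of a test
  -- function, whence ∫ψ w = c ∫ψ.
  let b : ContDiffBump ((t + T) / 2) :=
    ⟨(T - t) / 8, (T - t) / 4, by linarith, by linarith⟩
  set ψ₀ : ℝ → ℝ := b.normed volume with hψ₀
  have hb1 : ContDiff ℝ ∞ ψ₀ := b.contDiff_normed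
  have hb2 : HasCompactSupport ψ₀ := b.hasCompactSupport_normed
  have hb3 : tsupport ψ₀ ⊆ Ioo t T := by
    rw [hψ₀, b.tsupport_normed_eq, Real.closedBall_eq_Icc]
    intro s hs
    change s ∈ Icc ((t + T) / 2 - (T - t) / 4) ((t + T) / 2 + (T - t) / 4) at hs
    exact ⟨by linarith [hs.1], by linarith [hs.2]⟩
  have hb4 : ∫ s, ψ₀ s = 1 := b.integral_normed
  set c : ℝ := ∫ s in Ioo t T, ψ₀ s * w s with hcdef
  refine ⟨c, ?_⟩
  have hci : IntegrableOn (fun _ : ℝ => c) (Ioo t T) := by simp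
  have hfin : ∀ᵐ s ∂volume, s ∈ Ioo t T → w s - c = 0 := by
    refine isOpen_Ioo.ae_eq_zero_of_integral_contDiff_smul_eq_zero
      (hwi.sub hci).locallyIntegrableOn ?_
    intro ψ h1 h2 h3
    have hsupp : ∀ s, s ∉ Ioo t T → ψ s = 0 := fun s hs =>
      image_eq_zero_of_notMem_tsupport fun h' => hs (h3 h')
    have hiψ : Integrable ψ := h1.continuous.integrable_of_hasCompactSupport h2
    have hib : Integrable ψ₀ := hb1.continuous.integrable_of_hasCompactSupport hb2
    obtain ⟨η, e1, e2, e3, e4⟩ := exists_testFunction_deriv_eq (t := t) (T := T)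
      (θ := fun s => ψ s - (∫ r, ψ r) * ψ₀ s) (h1.sub (contDiff_const.mul hb1))
      (h2.sub hb2.mul_left) (by
        refine (tsupport_sub _ _).trans (union_subset h3 ((tsupport_mul_subset_right).trans hb3)))
      (by rw [integral_sub hiψ (hib.const_mul _), integral_const_mul, hb4, mul_one, sub_self])
    have e := hzero η e1 e2 e3
    rw [e4] at e
    simp only [sub_mul, mul_assoc] at e
    rw [integral_sub (hmul h1.continuous h2 hwi) ((hmul hb1.continuous hb2 hwi).const_mul _),
      integral_const_mul] at e
    have hψ : ∫ s in Ioo t T, ψ s = ∫ s, ψ s := setIntegral_eq_integral_of_forall_compl_eq_zero hsupp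
    rw [← setIntegral_eq_integral_of_forall_compl_eq_zero (s := Ioo t T)
      (fun s hs => by simp [hsupp s hs])]
    simp only [smul_eq_mul, mul_sub]
    rw [integral_sub (hmul h1.continuous h2 hwi) (hmul h1.continuous h2 hci), integral_mul_const,
      hψ, e]
  have hfin' := (ae_restrict_iff' measurableSet_Ioo).2 hfin
  filter_upwards [hfin'] with s hs
  simp only [hw] at hs
  linarith

/-- The derivative of an absolutely continuous function vanishes a.e. on each level set. -/
theorem ae_eq_zero_of_primitive_eq_zero {t T : ℝ} (htT : t ≤ T) {v : ℝ → ℝ}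
    (hv : IntegrableOn v (Ioo t T)) (c : ℝ) :
    ∀ᵐ s ∂(intervalMeasure t T), c + ∫ r in t..s, v r = 0 → v s = 0 := by
  set A : Set ℝ := {s | c + ∫ r in t..s, v r = 0} with hA
  -- Points of the level set isolated on the right are countable, hence negligible. Any other point
  -- is a limit of level-set points, so where the derivative exists it must be zero.
  have hcount : ∀ᵐ s : ℝ, s ∉ {x ∈ A | 𝓝[A ∩ Ioi x] x = ⊥} :=
    (countable_setOfPred_isolated_right_within (s := A)).ae_notMem volume
  rw [intervalMeasure, ae_restrict_iff' measurableSet_Ioo]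
  filter_upwards [hcount, (intervalIntegrable_of_integrableOn_Ioo htT hv).ae_hasDerivAt_integral]
    with s h1 h2 hs hsA
  have hd := (h2 (by rw [uIcc_of_le htT]; exact Ioo_subset_Icc_self hs) t left_mem_uIcc).const_add c
  rw [← hd.deriv]
  refine deriv_zero_of_frequently_const (c := 0) ?_
  have hne : (𝓝[A ∩ Ioi s] s).NeBot := ⟨fun h => h1 ⟨hsA, h⟩⟩
  have hle : 𝓝[A ∩ Ioi s] s ≤ 𝓝[≠] s := nhdsWithin_mono _ fun x hx => ne_of_gt hx.2
  have hev : ∀ᶠ x in 𝓝[A ∩ Ioi s] s, c + ∫ r in t..x, v r = 0 := by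
    filter_upwards [self_mem_nhdsWithin] with x hx using hx.1
  exact (hev.frequently).filter_mono hle

end

section

variable {N : ℕ} {p t T : ℝ} [Fact (1 < p)]

/-! ### Sobolev functions and trajectories -/

theorem integrable_Lp (u : LpSpace N p t T) : Integrable u (intervalMeasure t T) :=
  (Lp.memLp u).integrable factOneLe.out

theorem abs_coord_le_norm (z : Space N) (i : Fin N) : |z i| ≤ ‖z‖ := by
  simpa using PiLp.norm_apply_le z i

theorem integrable_Lp_coord (u : LpSpace N p t T) (i : Fin N) :
    Integrable (fun s => u s i) (intervalMeasure t T) :=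
  (EuclideanSpace.proj (𝕜 := ℝ) i).integrable_comp (integrable_Lp u)

theorem exists_integral_norm_le (N : ℕ) (p t T : ℝ) [Fact (1 < p)] :
    ∃ K : ℝ, 0 ≤ K ∧ ∀ u : LpSpace N p t T, ∫ s in Ioo t T, ‖u s‖ ≤ K * ‖u‖ := by
  set e : ℝ := 1 / (1 : ℝ≥0∞).toReal - 1 / (ENNReal.ofReal p).toReal with he
  have he0 : 0 ≤ e := by
    have hp : 1 < p := Fact.out
    rw [he, ENNReal.toReal_ofReal (by linarith), ENNReal.toReal_one, div_one, sub_nonneg]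
    exact (div_le_one (by linarith)).2 hp.le
  refine ⟨(intervalMeasure t T univ ^ e).toReal, ENNReal.toReal_nonneg, fun u => ?_⟩
  have h := eLpNorm_le_eLpNorm_mul_rpow_measure_univ (μ := intervalMeasure t T)
    (factOneLe (p := p)).out (Lp.aestronglyMeasurable u)
  have htop : intervalMeasure t T univ ^ e ≠ ⊤ :=
    ENNReal.rpow_ne_top_of_nonneg he0 (measure_ne_top _ _)
  have h1 := ENNReal.toReal_mono (ENNReal.mul_ne_top (Lp.eLpNorm_ne_top u) htop) h
  rw [ENNReal.toReal_mul, mul_comm] at h1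
  rw [integral_norm_eq_lintegral_enorm (Lp.aestronglyMeasurable u), ← eLpNorm_one_eq_lintegral_enorm]
  exact h1

theorem integrable_mul_Lp_coord {w : ℝ → ℝ}
    (hw : AEStronglyMeasurable w (intervalMeasure t T)) {C : ℝ} (hC : ∀ s ∈ Ioo t T, |w s| ≤ C)
    (i : Fin N) (u : LpSpace N p t T) :
    Integrable (fun s => w s * u s i) (intervalMeasure t T) := by
  refine (integrable_Lp_coord u i).bdd_mul hw (c := C) ?_
  filter_upwards [ae_restrict_mem measurableSet_Ioo] with s hs using hC s hs

/-- Integration against a bounded weight is a continuous linear functional. -/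
theorem exists_clm_integral_mul_coord (p : ℝ) [Fact (1 < p)] {w : ℝ → ℝ}
    (hw : AEStronglyMeasurable w (intervalMeasure t T)) {C : ℝ} (hC : ∀ s ∈ Ioo t T, |w s| ≤ C)
    (i : Fin N) :
    ∃ Φ : LpSpace N p t T →L[ℝ] ℝ, ∀ u, Φ u = ∫ s in Ioo t T, w s * u s i := by
  obtain ⟨K, hK, hKu⟩ := exists_integral_norm_le N p t T
  let L : LpSpace N p t T →ₗ[ℝ] ℝ :=
    { toFun := fun u => ∫ s in Ioo t T, w s * u s i
      map_add' := fun u v => by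
        rw [← integral_add (integrable_mul_Lp_coord hw hC i u) (integrable_mul_Lp_coord hw hC i v)]
        refine integral_congr_ae ?_
        filter_upwards [Lp.coeFn_add u v] with s hs
        simp only [hs, Pi.add_apply, PiLp.add_apply, mul_add]
      map_smul' := fun c u => by
        rw [RingHom.id_apply, smul_eq_mul, ← integral_const_mul]
        refine integral_congr_ae ?_
        filter_upwards [Lp.coeFn_smul c u] with s hs
        simp only [hs, Pi.smul_apply, PiLp.smul_apply, smul_eq_mul]
        ring }
  refine ⟨L.mkContinuous (|C| * K) fun u => ?_, fun u => rfl⟩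
  calc ‖∫ s in Ioo t T, w s * u s i‖ ≤ ∫ s in Ioo t T, |C| * ‖u s‖ := by
        refine norm_integral_le_of_norm_le ((integrable_Lp u).norm.const_mul _) ?_
        filter_upwards [ae_restrict_mem measurableSet_Ioo] with s hs
        rw [norm_mul]
        have h1 := (hC s hs).trans (le_abs_self C)
        have h2 := abs_coord_le_norm (u s) i
        rw [Real.norm_eq_abs, Real.norm_eq_abs]
        gcongr
    _ = |C| * ∫ s in Ioo t T, ‖u s‖ := integral_const_mul _ _
    _ ≤ |C| * (K * ‖u‖) := by gcongr; exact hKu u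
    _ = |C| * K * ‖u‖ := by ring

/-- The position, as a continuous linear map. -/
noncomputable def posCLM (N : ℕ) (p t T : ℝ) [Fact (1 < p)] :
    Sobolev N p t T →L[ℝ] LpSpace N p t T :=
  (WithLp.fstL (ENNReal.ofReal p) ℝ (LpSpace N p t T) (LpSpace N p t T)).comp
    (sobolev N p t T).subtypeL

/-- The velocity, as a continuous linear map. -/
noncomputable def velCLM (N : ℕ) (p t T : ℝ) [Fact (1 < p)] :
    Sobolev N p t T →L[ℝ] LpSpace N p t T :=
  (WithLp.sndL (ENNReal.ofReal p) ℝ (LpSpace N p t T) (LpSpace N p t T)).comp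
    (sobolev N p t T).subtypeL

theorem continuous_weakSpace_clm (Φ : Sobolev N p t T →L[ℝ] ℝ) :
    Continuous fun Y : WeakSpace ℝ (Sobolev N p t T) =>
      Φ ((toWeakSpace ℝ (Sobolev N p t T)).symm Y) :=
  WeakBilin.eval_continuous (topDualPairing ℝ (Sobolev N p t T)).flip Φ

theorem continuous_weakSpace_integral_vel {w : ℝ → ℝ}
    (hw : AEStronglyMeasurable w (intervalMeasure t T)) {C : ℝ} (hC : ∀ s ∈ Ioo t T, |w s| ≤ C)
    (i : Fin N) :
    Continuous fun Y : WeakSpace ℝ (Sobolev N p t T) =>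
      ∫ s in Ioo t T, w s * vel ((toWeakSpace ℝ (Sobolev N p t T)).symm Y) s i := by
  obtain ⟨Φ, hΦ⟩ := exists_clm_integral_mul_coord p hw hC i
  convert continuous_weakSpace_clm (Φ.comp (velCLM N p t T)) using 2 with Y
  exact (hΦ _).symm

theorem continuous_weakSpace_integral_pos {w : ℝ → ℝ}
    (hw : AEStronglyMeasurable w (intervalMeasure t T)) {C : ℝ} (hC : ∀ s ∈ Ioo t T, |w s| ≤ C)
    (i : Fin N) :
    Continuous fun Y : WeakSpace ℝ (Sobolev N p t T) =>
      ∫ s in Ioo t T, w s * pos ((toWeakSpace ℝ (Sobolev N p t T)).symm Y) s i := by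
  obtain ⟨Φ, hΦ⟩ := exists_clm_integral_mul_coord p hw hC i
  convert continuous_weakSpace_clm (Φ.comp (posCLM N p t T)) using 2 with Y
  exact (hΦ _).symm

theorem integrable_vel (Y : Sobolev N p t T) : Integrable (vel Y) (intervalMeasure t T) :=
  integrable_Lp Y.1.snd

theorem integrable_vel_coord (Y : Sobolev N p t T) (i : Fin N) :
    Integrable (fun s => vel Y s i) (intervalMeasure t T) :=
  integrable_Lp_coord Y.1.snd i

theorem integrable_norm_vel_rpow (Y : Sobolev N p t T) :
    Integrable (fun s => ‖vel Y s‖ ^ p) (intervalMeasure t T) := by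
  have hp : 1 < p := Fact.out
  have := (Lp.memLp Y.1.snd).integrable_norm_rpow (by simpa using by linarith) ENNReal.ofReal_ne_top
  rwa [ENNReal.toReal_ofReal (by linarith)] at this

/-- The continuous function starting from `x` with the same weak derivative as `Y`. -/
noncomputable def trajectory (x : Space N) (Y : Sobolev N p t T) (s : ℝ) : Space N :=
  WithLp.toLp 2 fun i => x i + ∫ r in t..s, vel Y r i

@[simp]
theorem trajectory_apply (x : Space N) (Y : Sobolev N p t T) (s : ℝ) (i : Fin N) :
    trajectory x Y s i = x i + ∫ r in t..s, vel Y r i := rfl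

@[simp]
theorem trajectory_start (x : Space N) (Y : Sobolev N p t T) : trajectory x Y t = x := by
  ext i; simp

theorem continuousOn_trajectory (htT : t ≤ T) (x : Space N) (Y : Sobolev N p t T) :
    ContinuousOn (trajectory x Y) (Icc t T) := by
  refine (PiLp.continuous_toLp 2 _).comp_continuousOn (continuousOn_pi.2 fun i => ?_)
  exact continuousOn_const.add
    (continuousOn_primitive_of_integrableOn_Ioo htT (integrable_vel_coord Y i))

theorem exists_pos_ae_eq_trajectory (htT : t < T) (Y : Sobolev N p t T) :
    ∃ c : Space N, pos Y =ᵐ[intervalMeasure t T] trajectory c Y := by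
  have h : ∀ i, ∃ c : ℝ, (fun s => pos Y s i) =ᵐ[intervalMeasure t T]
      fun s => c + ∫ r in t..s, vel Y r i := by
    intro i
    refine ae_eq_const_add_primitive htT (integrable_Lp_coord Y.1.fst i)
      (integrable_vel_coord Y i) fun η h1 h2 h3 => ?_
    have hd : Continuous (deriv η) := h1.continuous_deriv (by simp)
    have h := congrArg (EuclideanSpace.proj (𝕜 := ℝ) i) (Y.2 η h1 h2 h3)
    rw [map_neg, ← ContinuousLinearMap.integral_comp_comm _ (integrable_smul_Lp _ hd h2.deriv),
      ← ContinuousLinearMap.integral_comp_comm _ (integrable_smul_Lp _ h1.continuous h2)] at h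
    exact h
  choose c hc using h
  refine ⟨WithLp.toLp 2 c, ?_⟩
  filter_upwards [ae_all_iff.2 hc] with s hs
  ext i
  exact hs i

/-- Two continuous representatives that agree a.e. on (t, T) agree on all of [t, T]; evaluating at t
identifies the integration constant with x. -/
theorem pos_ae_eq_trajectory (htT : t < T) {x : Space N} {Y : Sobolev N p t T}
    (hY : Y ∈ admissible p t T x) : pos Y =ᵐ[intervalMeasure t T] trajectory x Y ∧
      ∀ s ∈ Icc t T, trajectory x Y s ∈ junction N := by
  obtain ⟨y, hyc, hyj, hyt, hy⟩ := hY
  obtain ⟨c, hc⟩ := exists_pos_ae_eq_trajectory htT Y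
  have he : EqOn y (trajectory c Y) (Icc t T) := by
    have h := hy.symm.trans hc
    rw [intervalMeasure, restrict_Ioo_eq_restrict_Ioc, restrict_Ioc_eq_restrict_Icc] at h
    refine Measure.eqOn_of_ae_eq h hyc (continuousOn_trajectory htT.le c Y) ?_
    rw [interior_Icc, closure_Ioo htT.ne]
  have hx : c = x := by
    have := he (left_mem_Icc.2 htT.le)
    rw [trajectory_start, hyt] at this
    exact this.symm
  subst hx
  exact ⟨hc, fun s hs => by rw [← he hs]; exact hyj s hs⟩

theorem mem_admissible_of_trajectory (htT : t ≤ T) {x : Space N} {Y : Sobolev N p t T}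
    (h : pos Y =ᵐ[intervalMeasure t T] trajectory x Y)
    (hj : ∀ s ∈ Icc t T, trajectory x Y s ∈ junction N) : Y ∈ admissible p t T x :=
  ⟨trajectory x Y, continuousOn_trajectory htT x Y, hj, trajectory_start x Y, h⟩

theorem ae_vel_eq_zero_of_trajectory_eq_zero (htT : t ≤ T) (x : Space N) (Y : Sobolev N p t T) :
    ∀ᵐ s ∂(intervalMeasure t T), ∀ i, trajectory x Y s i = 0 → vel Y s i = 0 :=
  ae_all_iff.2 fun i => ae_eq_zero_of_primitive_eq_zero htT (integrable_vel_coord Y i) (x i)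

/-- The initial value is recovered by integrating the position and the velocity. -/
theorem integral_pos_add_integral_vel (htT : t < T) {x : Space N} {Y : Sobolev N p t T}
    (h : pos Y =ᵐ[intervalMeasure t T] trajectory x Y) (i : Fin N) :
    (∫ s in Ioo t T, 1 * pos Y s i) + ∫ s in Ioo t T, (s - T) * vel Y s i = (T - t) * x i := by
  have h1 : ∫ s in Ioo t T, 1 * pos Y s i = ∫ s in Ioo t T, (x i + ∫ r in t..s, vel Y r i) := by
    refine integral_congr_ae ?_
    filter_upwards [h] with s hs
    rw [hs, one_mul, trajectory_apply]
  have hV : IntegrableOn (fun s => ∫ r in t..s, vel Y r i) (Ioo t T) :=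
    ((continuousOn_primitive_of_integrableOn_Ioo htT.le (integrable_vel_coord Y i)).integrableOn_compact
      isCompact_Icc).mono_set Ioo_subset_Icc_self
  -- The weight s - T has derivative one and vanishes at T, so no boundary term remains.
  have h2 := setIntegral_deriv_mul_primitive htT.le (integrable_vel_coord Y i)
    (η := fun s => s - T) (by fun_prop)
  simp only [deriv_sub_const, deriv_id'', one_mul, sub_self, zero_mul, zero_sub] at h2
  rw [h1, integral_add (by simp) hV, h2]
  simp [htT.le]

/-- The value at s is x plus the velocity integrated against the indicator of (t, s], a bounded
weight and hence a weakly continuous functional. -/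
theorem tendsto_trajectory {x : Space N} {ι : Type*} {l : Filter ι} {Y : ι → Sobolev N p t T}
    {Z : Sobolev N p t T}
    (h : Tendsto (fun n => toWeakSpace ℝ (Sobolev N p t T) (Y n)) l
      (𝓝 (toWeakSpace ℝ (Sobolev N p t T) Z))) {s : ℝ} (hs : s ∈ Icc t T) :
    Tendsto (fun n => trajectory x (Y n) s) l (𝓝 (trajectory x Z s)) := by
  refine ((PiLp.continuous_toLp 2 _).tendsto _).comp (tendsto_pi_nhds.2 fun i => ?_)
  refine tendsto_const_nhds.add ?_
  have key : ∀ Y : Sobolev N p t T, ∫ r in t..s, vel Y r i =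
      ∫ r in Ioo t T, (Ioc t s).indicator (fun _ => (1 : ℝ)) r * vel Y r i := by
    intro Y
    have : (fun r => (Ioc t s).indicator (fun _ => (1 : ℝ)) r * vel Y r i) =
        (Ioc t s).indicator fun r => vel Y r i := by
      funext r
      by_cases hr : r ∈ Ioc t s <;> simp [hr]
    rw [this, restrict_Ioo_eq_restrict_Ioc, setIntegral_indicator measurableSet_Ioc,
      inter_eq_self_of_subset_right (Ioc_subset_Ioc_right hs.2),
      intervalIntegral.integral_of_le hs.1]
  simp_rw [key]
  have hc := continuous_weakSpace_integral_vel (p := p) (t := t) (T := T)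
    (w := (Ioc t s).indicator fun _ => (1 : ℝ)) (C := 1)
    ((measurable_const.indicator measurableSet_Ioc).aestronglyMeasurable)
    (fun r _ => by by_cases hr : r ∈ Ioc t s <;> simp [hr]) i
  exact (hc.tendsto _).comp h

/-- `Γ_t[x]` is sequentially weakly closed. -/
theorem mem_admissible_of_tendsto_weak (htT : t < T) {x : Space N} {ι : Type*} {l : Filter ι}
    [l.NeBot] {Y : ι → Sobolev N p t T} {Z : Sobolev N p t T}
    (hY : ∀ n, Y n ∈ admissible p t T x)
    (h : Tendsto (fun n => toWeakSpace ℝ (Sobolev N p t T) (Y n)) l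
      (𝓝 (toWeakSpace ℝ (Sobolev N p t T) Z))) : Z ∈ admissible p t T x := by
  obtain ⟨c, hc⟩ := exists_pos_ae_eq_trajectory htT Z
  -- The starting point, times T - t, is a sum of two weakly continuous functionals of the curve, so
  -- it passes to the limit.
  have hcx : c = x := by
    ext i
    have h1 := continuous_weakSpace_integral_pos (p := p) (t := t) (T := T)
      (w := fun _ => (1 : ℝ)) (C := 1) aestronglyMeasurable_const (by simp) i
    have h2 := continuous_weakSpace_integral_vel (p := p) (t := t) (T := T)
      (w := fun s => s - T) (C := T - t) (by fun_prop)
      (fun s hs => by rw [abs_le]; constructor <;> linarith [hs.1, hs.2]) i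
    have h3 := ((h1.add h2).tendsto _).comp h
    simp only [Function.comp_def, Pi.add_apply, LinearEquiv.symm_apply_apply] at h3
    rw [integral_pos_add_integral_vel htT hc] at h3
    have h4 := tendsto_nhds_unique h3 (tendsto_const_nhds.congr fun n =>
      (integral_pos_add_integral_vel htT (pos_ae_eq_trajectory htT (hY n)).1 i).symm)
    exact mul_left_cancel₀ (by linarith : T - t ≠ 0) h4
  subst hcx
  refine mem_admissible_of_trajectory htT.le hc fun s hs => ?_
  exact isClosed_junction.mem_of_tendsto (tendsto_trajectory h hs)
    (Eventually.of_forall fun n => (pos_ae_eq_trajectory htT (hY n)).2 s hs)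

end

section

variable {N : ℕ} {p t T : ℝ} [Fact (1 < p)] {ℓ : Fin N → ℝ → ℝ → ℝ → ℝ} {ℓs : ℝ → ℝ}

/-! ### Costs along admissible trajectories -/

/-- Almost everywhere, a trajectory is either at rest at the vertex, or in the interior of an edge
with velocity along this edge. -/
theorem ae_vertex_or_edge (htT : t < T) {x : Space N} {Y : Sobolev N p t T}
    (hY : Y ∈ admissible p t T x) : ∀ᵐ s ∂(intervalMeasure t T),
      s ∈ Ioo t T ∧ pos Y s = trajectory x Y s ∧ ((pos Y s = 0 ∧ vel Y s = 0) ∨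
        ∃ i, pos Y s ∈ edge i ∧ pos Y s ≠ 0 ∧ vel Y s ∈ axisLine i) := by
  obtain ⟨h1, h2⟩ := pos_ae_eq_trajectory htT hY
  filter_upwards [h1, ae_vel_eq_zero_of_trajectory_eq_zero htT.le x Y,
    ae_restrict_mem measurableSet_Ioo] with s hs hv hsm
  refine ⟨hsm, hs, ?_⟩
  rw [← hs] at hv
  -- At the vertex every coordinate vanishes; on J_i all but the i-th do. The level-set property
  -- kills the matching velocity coordinates.
  by_cases h0 : pos Y s = 0
  · refine Or.inl ⟨h0, ?_⟩
    ext i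
    exact hv i (by simp [h0])
  · have hj := h2 s (Ioo_subset_Icc_self hsm)
    rw [← hs] at hj
    obtain ⟨i, hi⟩ := mem_iUnion.1 hj
    exact Or.inr ⟨i, hi, h0, mem_axisLine_iff.2 fun j hji => hv j ((mem_edge_iff.1 hi).2 j hji)⟩

theorem costAlong_of_pos_eq_zero {Y : Sobolev N p t T} {s : ℝ} (h : pos Y s = 0) :
    costAlong ℓ ℓs Y s = vertexCost ℓ ℓs s := by
  rw [costAlong, h, runningCost_zero]

theorem costAlong_of_mem_edge {Y : Sobolev N p t T} {s : ℝ} {i : Fin N} (h : pos Y s ∈ edge i)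
    (h0 : pos Y s ≠ 0) : costAlong ℓ ℓs Y s = ℓ i (pos Y s i) (vel Y s i) s := by
  rw [costAlong, runningCost_of_mem_edge ℓ ℓs h h0]

theorem exists_norm_trajectory_le (htT : t ≤ T) (x : Space N) (Y : Sobolev N p t T) :
    ∃ R, 0 < R ∧ ∀ s ∈ Icc t T, ‖trajectory x Y s‖ ≤ R := by
  obtain ⟨R, hR⟩ := isCompact_Icc.exists_bound_of_continuousOn (continuousOn_trajectory htT x Y)
  exact ⟨max R 1, by positivity, fun s hs => (hR s hs).trans (le_max_left _ _)⟩

theorem measurable_vel (Y : Sobolev N p t T) : Measurable (vel Y) :=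
  (Lp.stronglyMeasurable Y.1.snd).measurable

theorem measurable_pos (Y : Sobolev N p t T) : Measurable (pos Y) :=
  (Lp.stronglyMeasurable Y.1.fst).measurable

namespace IsRunningCost

theorem phi_eq_costAlong (hℓ : IsRunningCost p T ℓ ℓs) (ht : 0 ≤ t) (htT : t < T) {x : Space N}
    {Y : Sobolev N p t T} (hY : Y ∈ admissible p t T x) : ∀ᵐ s ∂(intervalMeasure t T),
      phi ℓ ℓs (pos Y s) (vel Y s) s = (costAlong ℓ ℓs Y s : EReal) := by
  filter_upwards [ae_vertex_or_edge htT hY] with s hs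
  obtain ⟨hsm, -, ⟨h0, hv⟩ | ⟨i, hi, h0, hv⟩⟩ := hs
  · rw [costAlong_of_pos_eq_zero h0, phi, if_pos h0, hv,
      hℓ.vertexEnvelope_zero ⟨ht.trans hsm.1.le, hsm.2.le⟩]
  · rw [costAlong_of_mem_edge hi h0, phi_of_mem_edge hi h0 hv]

variable [NeZero N]

theorem aestronglyMeasurable_costAlong (hℓ : IsRunningCost p T ℓ ℓs) (ht : 0 ≤ t) (htT : t < T)
    (Y : Sobolev N p t T) :
    AEStronglyMeasurable (costAlong ℓ ℓs Y) (intervalMeasure t T) := by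
  classical
  have hT : 0 ≤ T := ht.trans htT.le
  have hpos := measurable_pos Y
  have hvel := measurable_vel Y
  have hv : Continuous fun s => vertexCost ℓ ℓs (clampTime T s) :=
    hℓ.continuousOn_vertexCost.comp_continuous (continuous_clampTime T) (clampTime_mem hT)
  have hm : Measurable fun s => (∑ i, if pos Y s ∈ edge i \ {0} then
      costExt T ℓ i (‖pos Y s‖, vel Y s i, s) else 0) +
      if pos Y s = 0 then vertexCost ℓ ℓs (clampTime T s) else 0 := by
    refine (Finset.measurable_fun_sum _ fun i _ => ?_).add ?_
    · refine Measurable.ite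
        (hpos ((isClosed_edge i).measurableSet.diff (measurableSet_singleton 0))) ?_ measurable_const
      exact (hℓ.continuous_costExt hT i).measurable.comp (hpos.norm.prodMk
        (((EuclideanSpace.proj (𝕜 := ℝ) i).continuous.measurable.comp hvel).prodMk measurable_id))
    · exact Measurable.ite (hpos (measurableSet_singleton 0)) hv.measurable measurable_const
  refine hm.aestronglyMeasurable.congr ?_
  filter_upwards [ae_restrict_mem measurableSet_Ioo] with s hs
  have hs' : s ∈ Icc 0 T := ⟨ht.trans hs.1.le, hs.2.le⟩
  simp only [costAlong, runningCost, clampTime_of_mem hs']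
  congr 1
  · refine Finset.sum_congr rfl fun i _ => ?_
    rw [costExt_of_mem ℓ i (norm_nonneg _) _ hs']

theorem integrable_costAlong (hℓ : IsRunningCost p T ℓ ℓs) (ht : 0 ≤ t) (htT : t < T)
    {x : Space N} {Y : Sobolev N p t T} (hY : Y ∈ admissible p t T x) :
    IntegrableOn (costAlong ℓ ℓs Y) (Ioo t T) := by
  have hp : 1 < p := Fact.out
  obtain ⟨R, hR, hRY⟩ := exists_norm_trajectory_le htT.le x Y
  obtain ⟨C, hC, hCℓ⟩ := hℓ.abs_le_growth hp (ht.trans htT.le) hR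
  obtain ⟨V, hV⟩ := isCompact_Icc.exists_bound_of_continuousOn hℓ.continuousOn_vertexCost
  have hg : Integrable (fun s => |V| + C * (1 + ‖vel Y s‖ ^ p)) (intervalMeasure t T) :=
    (integrable_const _).add (((integrable_const _).add (integrable_norm_vel_rpow Y)).const_mul C)
  refine hg.mono' (hℓ.aestronglyMeasurable_costAlong ht htT Y) ?_
  filter_upwards [ae_vertex_or_edge htT hY] with s hs
  have hnn : 0 ≤ C * (1 + ‖vel Y s‖ ^ p) := by positivity
  obtain ⟨hsm, hpos, ⟨h0, hv⟩ | ⟨i, hi, h0, hv⟩⟩ := hs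
  · have hs' : s ∈ Icc 0 T := ⟨ht.trans hsm.1.le, hsm.2.le⟩
    rw [costAlong_of_pos_eq_zero h0]
    linarith [hV s hs', le_abs_self V]
  · have hs' : s ∈ Icc 0 T := ⟨ht.trans hsm.1.le, hsm.2.le⟩
    rw [costAlong_of_mem_edge hi h0, norm_of_mem_axisLine hv, Real.norm_eq_abs]
    have h1 : pos Y s i ≤ R := by
      rw [← norm_of_mem_edge hi, hpos]
      exact hRY s (Ioo_subset_Icc_self hsm)
    linarith [hCℓ i (pos Y s i) ⟨(mem_edge_iff.1 hi).1, h1⟩ (vel Y s i) s hs', abs_nonneg V]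


end IsRunningCost

/-- The coercivity bound along trajectories. -/
theorem ae_coercive_le_costAlong [NeZero N] (ht : 0 ≤ t) (htT : t < T) {C₀ c₀ : ℝ}
    (hc : ∀ i, ∀ y ≥ 0, ∀ a : ℝ, ∀ s ∈ Icc 0 T, C₀ * |a| ^ p + c₀ ≤ ℓ i y a s)
    (hcs : ∀ s ∈ Icc 0 T, c₀ ≤ ℓs s)
    {x : Space N} {Y : Sobolev N p t T} (hY : Y ∈ admissible p t T x) :
    ∀ᵐ s ∂(intervalMeasure t T), C₀ * ‖vel Y s‖ ^ p + c₀ ≤ costAlong ℓ ℓs Y s := by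
  have hp : 1 < p := Fact.out
  have hp0 : (0 : ℝ) ^ p = 0 := Real.zero_rpow (by linarith)
  filter_upwards [ae_vertex_or_edge htT hY] with s hs
  obtain ⟨hsm, hpos, ⟨h0, hv⟩ | ⟨i, hi, h0, hv⟩⟩ := hs
  · have hs' : s ∈ Icc 0 T := ⟨ht.trans hsm.1.le, hsm.2.le⟩
    rw [costAlong_of_pos_eq_zero h0, hv, norm_zero, hp0, mul_zero, zero_add]
    refine IsRunningCost.le_vertexCost (fun i => ?_) (hcs s hs')
    simpa [hp0] using hc i 0 le_rfl 0 s hs'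
  · have hs' : s ∈ Icc 0 T := ⟨ht.trans hsm.1.le, hsm.2.le⟩
    rw [costAlong_of_mem_edge hi h0, norm_of_mem_axisLine hv]
    exact hc i _ (mem_edge_iff.1 hi).1 _ s hs'

/-! ### Equicontinuity -/

/-- Truncation at level r, in place of Hölder's inequality: r large serves equicontinuity, r = 1 the
L¹ bound on velocities. -/
theorem le_add_rpow_mul_rpow {p : ℝ} (hp : 1 < p) {a r : ℝ} (ha : 0 ≤ a) (hr : 0 < r) :
    a ≤ r + r ^ (1 - p) * a ^ p := by
  rcases le_total a r with h | h
  · have : 0 ≤ r ^ (1 - p) * a ^ p := by positivity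
    linarith
  · have ha' : 0 < a := hr.trans_le h
    have h1 : a ^ (1 - p) ≤ r ^ (1 - p) :=
      Real.rpow_le_rpow_of_nonpos hr h (by linarith)
    have h2 : a ^ (1 - p) * a ^ p = a := by
      rw [← Real.rpow_add ha']; simp
    have h3 : a ^ (1 - p) * a ^ p ≤ r ^ (1 - p) * a ^ p := by gcongr
    linarith

/-- Sets of trajectories of bounded energy are equicontinuous. -/
theorem exists_equicontinuous_trajectory (N : ℕ) (t T : ℝ) (B : ℝ) {η : ℝ} (hη : 0 < η) :
    ∃ ρ, 0 < ρ ∧ ∀ (x : Space N) (Y : Sobolev N p t T), ∫ s in Ioo t T, ‖vel Y s‖ ^ p ≤ B →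
      ∀ s ∈ Icc t T, ∀ s' ∈ Icc t T, |s - s'| < ρ → ∀ i,
        |trajectory x Y s i - trajectory x Y s' i| ≤ η := by
  have hp : 1 < p := Fact.out
  have hlim : Tendsto (fun r : ℝ => r ^ (1 - p) * B) atTop (𝓝 0) := by
    have := (tendsto_rpow_neg_atTop (by linarith : 0 < p - 1)).mul_const B
    simpa using this
  -- First r makes the energy part r^(1-p) B less than η/2; then |s - s'| < η/(2r) bounds the part r
  -- |s - s'| by η/2.
  obtain ⟨r, hr1, hr⟩ := ((hlim.eventually (gt_mem_nhds (half_pos hη))).and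
    (eventually_gt_atTop 0)).exists
  refine ⟨η / (2 * r), by positivity, fun x Y hY s hs s' hs' hss i => ?_⟩
  wlog h : s ≤ s' generalizing s s'
  · rw [abs_sub_comm]
    exact this s' hs' s hs (by rwa [abs_sub_comm]) (le_of_not_ge h)
  have htT : t ≤ T := hs.1.trans hs.2
  have hi := integrable_vel_coord Y i
  have hii : ∀ {u}, u ∈ Icc t T → IntervalIntegrable (fun r => vel Y r i) volume t u := fun hu =>
    (intervalIntegrable_of_integrableOn_Ioo htT hi).mono_set (by
      rw [uIcc_of_le hu.1, uIcc_of_le htT]; exact Icc_subset_Icc_right hu.2)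
  have hsub : Ioc s s' ⊆ Ioc t T := Ioc_subset_Ioc hs.1 hs'.2
  have hpi : IntegrableOn (fun q => ‖vel Y q‖ ^ p) (Ioc t T) := by
    have := integrable_norm_vel_rpow Y
    rwa [intervalMeasure, restrict_Ioo_eq_restrict_Ioc] at this
  have h1 : trajectory x Y s' i - trajectory x Y s i = ∫ q in Ioc s s', vel Y q i := by
    rw [trajectory_apply, trajectory_apply, add_sub_add_left_eq_sub,
      intervalIntegral.integral_interval_sub_left (hii hs') (hii hs),
      intervalIntegral.integral_of_le h]
  have h2 : ‖∫ q in Ioc s s', vel Y q i‖ ≤ ∫ q in Ioc s s', (r + r ^ (1 - p) * ‖vel Y q‖ ^ p) := by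
    refine norm_integral_le_of_norm_le ?_ (Eventually.of_forall fun q => ?_)
    · exact (integrable_const _).add ((hpi.mono_set hsub).const_mul _)
    · exact (abs_coord_le_norm _ i).trans (le_add_rpow_mul_rpow hp (norm_nonneg _) hr)
  have h3 : ∫ q in Ioc s s', ‖vel Y q‖ ^ p ≤ B := by
    refine le_trans ?_ hY
    rw [restrict_Ioo_eq_restrict_Ioc]
    exact setIntegral_mono_set hpi (Eventually.of_forall fun q => by positivity)
      hsub.eventuallyLE
  have h4 : ∫ q in Ioc s s', (r + r ^ (1 - p) * ‖vel Y q‖ ^ p)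
      = (s' - s) * r + r ^ (1 - p) * ∫ q in Ioc s s', ‖vel Y q‖ ^ p := by
    rw [integral_add (integrable_const _) ((hpi.mono_set hsub).const_mul _), integral_const_mul]
    simp [h]
  have h5 : r ^ (1 - p) * ∫ q in Ioc s s', ‖vel Y q‖ ^ p ≤ r ^ (1 - p) * B := by gcongr
  have h6 : (s' - s) * r ≤ η / 2 := by
    rw [abs_sub_comm, abs_of_nonneg (by linarith), lt_div_iff₀ (by positivity)] at hss
    linarith
  rw [abs_sub_comm, h1, ← Real.norm_eq_abs]
  linarith

/-- On sets of bounded energy, weak convergence of trajectories implies uniform convergence. -/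
theorem eventually_trajectory_close (x : Space N) (Z : Sobolev N p t T) (B : ℝ)
    {η : ℝ} (hη : 0 < η) :
    ∀ᶠ Y in 𝓝 (toWeakSpace ℝ (Sobolev N p t T) Z),
      ∫ s in Ioo t T, ‖vel ((toWeakSpace ℝ (Sobolev N p t T)).symm Y) s‖ ^ p ≤ B →
      ∀ s ∈ Icc t T, ∀ i,
        |trajectory x ((toWeakSpace ℝ (Sobolev N p t T)).symm Y) s i - trajectory x Z s i| < η := by
  -- The maximum gives Z the same modulus of continuity as Y. The total η is η/4 for each curve plus
  -- η/2 on a finite ρ-net, where weak convergence gives pointwise closeness.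
  obtain ⟨ρ, hρ, hequi⟩ := exists_equicontinuous_trajectory (p := p) N t T
    (max B (∫ s in Ioo t T, ‖vel Z s‖ ^ p)) (by positivity : 0 < η / 4)
  obtain ⟨F, hF, hFfin, hcov⟩ := (isCompact_Icc (a := t) (b := T)).finite_cover_balls hρ
  have hev : ∀ᶠ Y in 𝓝 (toWeakSpace ℝ (Sobolev N p t T) Z), ∀ f ∈ F, ∀ i,
      |trajectory x ((toWeakSpace ℝ (Sobolev N p t T)).symm Y) f i - trajectory x Z f i| < η / 2 := by
    refine (eventually_all_finite hFfin).2 fun f hf => eventually_all.2 fun i => ?_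
    have h1 : Tendsto (fun Y => trajectory x ((toWeakSpace ℝ (Sobolev N p t T)).symm Y) f)
        (𝓝 (toWeakSpace ℝ (Sobolev N p t T) Z)) (𝓝 (trajectory x Z f)) :=
      tendsto_trajectory (by simp only [LinearEquiv.apply_symm_apply]; exact tendsto_id) (hF hf)
    have h2 := ((EuclideanSpace.proj (𝕜 := ℝ) i).continuous.tendsto _).comp h1
    have h3 := Metric.tendsto_nhds.1 h2 (η / 2) (by positivity)
    simpa [Real.dist_eq] using h3
  filter_upwards [hev] with Y hY hB s hs i
  obtain ⟨f, hf, hsf⟩ := mem_iUnion₂.1 (hcov hs)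
  rw [Metric.mem_ball, Real.dist_eq] at hsf
  have e1 := hequi x _ (hB.trans (le_max_left _ _)) s hs f (hF hf) hsf i
  have e2 := hequi x Z (le_max_right _ _) s hs f (hF hf) hsf i
  have e3 := hY f hf i
  rw [abs_le] at e1 e2
  rw [abs_lt] at e3 ⊢
  constructor <;> linarith

end

section

variable {N : ℕ} {p t T : ℝ} [Fact (1 < p)] {ℓ : Fin N → ℝ → ℝ → ℝ → ℝ} {ℓs : ℝ → ℝ}

/-! ### Lower semicontinuity -/

/-- The pointwise comparison of the costs along two uniformly close trajectories. -/
theorem costAlong_ge_of_close {R M ε η δ : ℝ} (hε : 0 ≤ ε)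
    (htan : ∀ i, ∀ y ∈ Icc 0 R, ∀ z ∈ Icc 0 R, |y - z| < η → ∀ b, |b| ≤ M → ∀ a,
      ∀ s ∈ Icc 0 T, ℓ i z b s + slopeExt T ℓ i (z, b, s) * (a - b) - ε * (1 + |a| + |b|)
        ≤ ℓ i y a s) (hηδ : η ≤ δ) (hM : 0 ≤ M)
    {Y Z : Sobolev N p t T} {s : ℝ} (hs : s ∈ Icc 0 T)
    (hY : (pos Y s = 0 ∧ vel Y s = 0) ∨ ∃ i, pos Y s ∈ edge i ∧ pos Y s ≠ 0 ∧ vel Y s ∈ axisLine i)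
    (hZ : (pos Z s = 0 ∧ vel Z s = 0) ∨ ∃ i, pos Z s ∈ edge i ∧ pos Z s ≠ 0 ∧ vel Z s ∈ axisLine i)
    (hYR : ‖pos Y s‖ ≤ R) (hZR : ‖pos Z s‖ ≤ R) (hYZ : ∀ i, |pos Y s i - pos Z s i| < η)
    (hZM : ‖vel Z s‖ ≤ M) (hZδ : pos Z s = 0 ∨ δ ≤ ‖pos Z s‖) :
    costAlong ℓ ℓs Z s
      + ∑ i, slopeExt T ℓ i (pos Z s i, vel Z s i, s) * (vel Y s i - vel Z s i)
      - ε * (1 + ‖vel Y s‖ + ‖vel Z s‖) ≤ costAlong ℓ ℓs Y s := by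
  have hsum : ∀ j, vel Y s ∈ axisLine j → vel Z s ∈ axisLine j →
      ∑ i, slopeExt T ℓ i (pos Z s i, vel Z s i, s) * (vel Y s i - vel Z s i)
        = slopeExt T ℓ j (pos Z s j, vel Z s j, s) * (vel Y s j - vel Z s j) := by
    intro j h1 h2
    refine Finset.sum_eq_single j (fun i _ hij => ?_) (by simp)
    rw [mem_axisLine_iff.1 h1 i hij, mem_axisLine_iff.1 h2 i hij, sub_self, mul_zero]
  have hzero_axis : ∀ j : Fin N, (0 : Space N) ∈ axisLine j := fun j =>
    edge_subset_axisLine j (zero_mem_edge j)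
  obtain ⟨hZ0, hZv⟩ | ⟨j, hZj, hZ0, hZv⟩ := hZ
  · obtain ⟨hY0, hYv⟩ | ⟨j, hYj, hY0, hYv⟩ := hY
    · rw [costAlong_of_pos_eq_zero hZ0, costAlong_of_pos_eq_zero hY0, hYv, hZv]
      simpa using hε
    -- Z rests at the vertex while Y moves on J_j: use the tangent to ℓ_j at (0, 0), whose value
    -- there is at least ℓ_0.
    · have hyR : pos Y s j ≤ R := by rwa [← norm_of_mem_edge hYj]
      have hy0 := (mem_edge_iff.1 hYj).1
      have h := htan j (pos Y s j) ⟨hy0, hyR⟩ (pos Z s j)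
        (by simpa [hZ0] using hy0.trans hyR) (hYZ j) (vel Z s j) (by simpa [hZv] using hM)
        (vel Y s j) s hs
      rw [hsum j hYv (by rw [hZv]; exact hzero_axis j), costAlong_of_pos_eq_zero hZ0,
        costAlong_of_mem_edge hYj hY0, norm_of_mem_axisLine hYv, hZv, norm_zero]
      have h2 := IsRunningCost.vertexCost_le ℓ ℓs j s
      simp only [hZ0, hZv, PiLp.zero_apply, abs_zero] at h ⊢
      linarith
  · have hz := coord_pos_of_mem_edge hZj hZ0
    have hzδ : δ ≤ pos Z s j := by
      rw [← norm_of_mem_edge hZj]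
      exact hZδ.resolve_left hZ0
    -- Z is at distance at least δ ≥ η from the vertex, so Y cannot have reached it and must be on
    -- the same edge.
    have hyj : 0 < pos Y s j := by
      have := (abs_lt.1 (hYZ j)).1
      linarith
    obtain ⟨hY0, hYv⟩ | ⟨k, hYk, hY0, hYv⟩ := hY
    · simp [hY0] at hyj
    · have hjk : j = k := by
        by_contra hjk
        exact hyj.ne' ((mem_edge_iff.1 hYk).2 j hjk)
      subst hjk
      have hyR : pos Y s j ≤ R := by rwa [← norm_of_mem_edge hYk]
      have hzR : pos Z s j ≤ R := by rwa [← norm_of_mem_edge hZj]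
      have h := htan j (pos Y s j) ⟨hyj.le, hyR⟩ (pos Z s j) ⟨hz.le, hzR⟩ (hYZ j) (vel Z s j)
        ((abs_coord_le_norm _ j).trans hZM) (vel Y s j) s hs
      rw [hsum j hYv hZv, costAlong_of_mem_edge hYk hY0, costAlong_of_mem_edge hZj hZ0,
        norm_of_mem_axisLine hYv, norm_of_mem_axisLine hZv]
      linarith

/-- An exhausting sequence of sets of times on which the velocity is bounded, and the position is
either at the vertex or away from it. -/
def goodTimes (z v : ℝ → Space N) (k : ℕ) : Set ℝ :=
  {s | ‖v s‖ ≤ k + 1 ∧ (z s = 0 ∨ 1 / ((k : ℝ) + 1) ≤ ‖z s‖)}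

theorem measurableSet_goodTimes {z v : ℝ → Space N} (hz : Measurable z) (hv : Measurable v)
    (k : ℕ) : MeasurableSet (goodTimes z v k) :=
  (measurableSet_le hv.norm measurable_const).inter
    ((hz (measurableSet_singleton 0)).union (measurableSet_le measurable_const hz.norm))

theorem monotone_goodTimes (z v : ℝ → Space N) : Monotone (goodTimes z v) := by
  intro k m hkm s hs
  have hkm' : (k : ℝ) ≤ m := by exact_mod_cast hkm
  refine ⟨hs.1.trans (by linarith), hs.2.imp id fun h => le_trans ?_ h⟩
  exact one_div_le_one_div_of_le (by positivity) (by linarith)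

theorem iUnion_goodTimes (z v : ℝ → Space N) : ⋃ k, goodTimes z v k = univ := by
  refine eq_univ_of_forall fun s => mem_iUnion.2 ?_
  obtain ⟨m, hm⟩ := exists_nat_ge ‖v s‖
  by_cases h0 : z s = 0
  · exact ⟨m, by linarith, Or.inl h0⟩
  · obtain ⟨n, hn⟩ := exists_nat_one_div_lt (norm_pos_iff.2 h0)
    refine ⟨max m n, ?_, Or.inr (le_trans ?_ hn.le)⟩
    · have : (m : ℝ) ≤ (max m n : ℕ) := by exact_mod_cast le_max_left m n
      linarith
    · have : (n : ℝ) ≤ (max m n : ℕ) := by exact_mod_cast le_max_right m n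
      exact one_div_le_one_div_of_le (by positivity) (by linarith)

theorem IsRunningCost.lowerSemicontinuousOn_costFunctional [NeZero N]
    (hℓ : IsRunningCost p T ℓ ℓs) (ht : 0 ≤ t) (htT : t < T) (x : Space N) :
    LowerSemicontinuousOn
      (fun Y : WeakSpace ℝ (Sobolev N p t T) =>
        costFunctional ℓ ℓs ((toWeakSpace ℝ (Sobolev N p t T)).symm Y))
      {Y | (toWeakSpace ℝ (Sobolev N p t T)).symm Y ∈ admissible p t T x} := by
  classical
  have hp : 1 < p := Fact.out
  have hT : 0 ≤ T := ht.trans htT.le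
  intro Z' hZ' c hcZ'
  obtain ⟨Z, rfl⟩ := (toWeakSpace ℝ (Sobolev N p t T)).surjective Z'
  have hZ : Z ∈ admissible p t T x := by simpa using hZ'
  have hcZ : c < costFunctional ℓ ℓs Z := by simpa using hcZ'
  obtain ⟨C₀, hC₀, c₀, hc, hcs⟩ := hℓ.coercive
  obtain ⟨R₀, hR₀, hZR₀⟩ := exists_norm_trajectory_le htT.le x Z
  set ε₀ : ℝ := costFunctional ℓ ℓs Z - c with hε₀
  have hε₀pos : 0 < ε₀ := sub_pos.2 hcZ
  -- B bounds the energy of any admissible Y with j(Y) ≤ c, by coercivity. Then D bounds ∫ (1 + |Y'|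
  -- + |Z'|), and ε is chosen so that ε D = ε₀/4.
  set B : ℝ := (c - c₀ * (T - t)) / C₀ with hB
  set μ := intervalMeasure t T with hμ
  set D : ℝ := (T - t) + ((T - t) + |B|) + ∫ s in Ioo t T, ‖vel Z s‖ with hD
  have hvZ0 : 0 ≤ ∫ s in Ioo t T, ‖vel Z s‖ := integral_nonneg fun s => norm_nonneg _
  have hDpos : 0 < D := by
    have := abs_nonneg B
    linarith
  set ε : ℝ := ε₀ / (4 * D) with hε
  have hεpos : 0 < ε := by positivity
  set z : ℝ → Space N := IccExtend htT.le ((Icc t T).domRestrict (trajectory x Z)) with hz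
  have hzc : Continuous z :=
    (continuousOn_iff_continuous_domRestrict.1 (continuousOn_trajectory htT.le x Z)).Icc_extend'
  have hzt : ∀ s ∈ Icc t T, z s = trajectory x Z s := fun s hs => by
    rw [hz, IccExtend_of_mem htT.le _ hs]; rfl
  -- Subtracting c₀ makes the costs nonnegative a.e., so for Y the times outside the good set can
  -- simply be dropped.
  set h : ℝ → ℝ := fun s => costAlong ℓ ℓs Z s - c₀ with hh
  have hhi : Integrable h μ := (hℓ.integrable_costAlong ht htT hZ).sub (integrable_const _)
  have hGlim := tendsto_setIntegral_of_monotone (μ := μ) (f := h)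
    (measurableSet_goodTimes hzc.measurable (measurable_vel Z)) (monotone_goodTimes z (vel Z))
    hhi.integrableOn
  rw [iUnion_goodTimes, setIntegral_univ] at hGlim
  obtain ⟨k, hk⟩ := (hGlim.eventually
    (lt_mem_nhds (by linarith : ∫ s, h s ∂μ - ε₀ / 4 < ∫ s, h s ∂μ))).exists
  set G := goodTimes z (vel Z) k with hG
  have hGm : MeasurableSet G :=
    measurableSet_goodTimes hzc.measurable (measurable_vel Z) k
  set M : ℝ := (k : ℝ) + 1 with hMdef
  have hM : 0 < M := by positivity
  set R : ℝ := R₀ + 1 with hR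
  obtain ⟨η₀, hη₀, htan₀⟩ := hℓ.exists_uniform_tangent_le hT R M hεpos
  -- The three bounds serve the tangent estimate, the same-edge argument (Z is 0 or at distance at
  -- least 1/M from it on G) and the inclusion of Y in the ball of radius R₀ + 1.
  set η : ℝ := min (min η₀ (1 / M)) 1 with hη
  have hηpos : 0 < η := by positivity
  have hη1 : η ≤ 1 := min_le_right _ _
  have hηM : η ≤ 1 / M := (min_le_left _ _).trans (min_le_right _ _)
  have hηη₀ : η ≤ η₀ := (min_le_left _ _).trans (min_le_left _ _)
  -- Cutting off to G, where position and velocity of Z are bounded, makes the slopes bounded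
  -- weights, as weak continuity requires.
  set w : Fin N → ℝ → ℝ := fun i =>
    G.indicator fun s => slopeExt T ℓ i (z s i, vel Z s i, s) with hw
  have hvm : ∀ i, Measurable fun s => vel Z s i := fun i =>
    (EuclideanSpace.proj (𝕜 := ℝ) i).continuous.measurable.comp (measurable_vel Z)
  have hwm : ∀ i, AEStronglyMeasurable (w i) μ := fun i => by
    refine (Measurable.indicator ?_ hGm).aestronglyMeasurable
    exact (hℓ.continuous_slopeExt hT i).measurable.comp
      (((EuclideanSpace.proj (𝕜 := ℝ) i).continuous.comp hzc).measurable.prodMk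
        ((hvm i).prodMk measurable_id))
  have hwb : ∀ i, ∃ C, ∀ s ∈ Ioo t T, |w i s| ≤ C := fun i => by
    obtain ⟨C, hC⟩ := ((isCompact_Icc (a := -R₀) (b := R₀)).prod
      ((isCompact_Icc (a := -M) (b := M)).prod (isCompact_Icc (a := 0) (b := T)))).exists_bound_of_continuousOn
      (hℓ.continuous_slopeExt hT i).continuousOn
    refine ⟨max C 0, fun s hs => ?_⟩
    by_cases hsG : s ∈ G
    · rw [hw]
      simp only [indicator_of_mem hsG]
      refine (hC (z s i, vel Z s i, s) ⟨abs_le.1 ?_, abs_le.1 ?_,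
        ⟨ht.trans hs.1.le, hs.2.le⟩⟩).trans (le_max_left _ _)
      · rw [hzt s (Ioo_subset_Icc_self hs)]
        exact (abs_coord_le_norm _ i).trans (hZR₀ s (Ioo_subset_Icc_self hs))
      · exact (abs_coord_le_norm _ i).trans hsG.1
    · rw [hw]
      simp only [indicator_of_notMem hsG, abs_zero]
      exact le_max_right _ _
  choose C hC using hwb
  have hwev : ∀ᶠ Y in 𝓝 (toWeakSpace ℝ (Sobolev N p t T) Z),
      |(∑ i, ∫ s in Ioo t T, w i s * vel ((toWeakSpace ℝ (Sobolev N p t T)).symm Y) s i)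
        - ∑ i, ∫ s in Ioo t T, w i s * vel Z s i| < ε₀ / 4 := by
    have h1 := continuous_finsetSum Finset.univ fun i _ =>
      continuous_weakSpace_integral_vel (p := p) (hwm i) (hC i) i
    have h2 := Metric.tendsto_nhds.1 (h1.tendsto (toWeakSpace ℝ (Sobolev N p t T) Z)) (ε₀ / 4)
      (by positivity)
    simpa [Real.dist_eq] using h2
  filter_upwards [nhdsWithin_le_nhds hwev,
    nhdsWithin_le_nhds (eventually_trajectory_close x Z |B| hηpos), self_mem_nhdsWithin]
    with Y' hY1 hY2 hY
  set Y := (toWeakSpace ℝ (Sobolev N p t T)).symm Y' with hYdef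
  change Y ∈ admissible p t T x at hY
  change c < costFunctional ℓ ℓs Y
  -- Assuming j(Y) ≤ c supplies the energy bound that uniform closeness needs.
  by_contra hle
  rw [not_lt] at hle
  have hYi : Integrable (costAlong ℓ ℓs Y) μ := hℓ.integrable_costAlong ht htT hY
  have hconst : ∀ a : ℝ, ∫ _ in Ioo t T, a = (T - t) * a := fun a => by simp [htT.le]
  have hen : ∫ s in Ioo t T, ‖vel Y s‖ ^ p ≤ |B| := by
    have h1 := integral_mono_ae (((integrable_norm_vel_rpow Y).const_mul C₀).add
      (integrable_const c₀)) hYi (ae_coercive_le_costAlong ht htT hc hcs hY)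
    simp only [Pi.add_apply] at h1
    rw [integral_add ((integrable_norm_vel_rpow Y).const_mul C₀) (integrable_const c₀),
      integral_const_mul, hconst] at h1
    refine le_trans ?_ (le_abs_self B)
    rw [hB, le_div_iff₀ hC₀]
    change _ ≤ costFunctional ℓ ℓs Y at h1
    linarith
  have hvY : ∫ s in Ioo t T, ‖vel Y s‖ ≤ (T - t) + |B| := by
    have h1 := integral_mono (integrable_vel Y).norm
      ((integrable_const (1 : ℝ)).add (integrable_norm_vel_rpow Y)) (fun s => by
        have := le_add_rpow_mul_rpow hp (norm_nonneg (vel Y s)) one_pos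
        simpa using this)
    simp only [Pi.add_apply] at h1
    rw [integral_add (integrable_const _) (integrable_norm_vel_rpow Y), hconst] at h1
    linarith
  have hclose := hY2 hen
  have hnn := ae_coercive_le_costAlong ht htT hc hcs hY
  have hpt : ∀ᵐ s ∂μ, G.indicator h s + (∑ i, (w i s * vel Y s i - w i s * vel Z s i))
      - ε * (1 + ‖vel Y s‖ + ‖vel Z s‖) ≤ costAlong ℓ ℓs Y s - c₀ := by
    filter_upwards [ae_vertex_or_edge htT hY, ae_vertex_or_edge htT hZ, hnn]
      with s ⟨hsm, hpY, hstY⟩ ⟨_, hpZ, hstZ⟩ hn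
    have hs' : s ∈ Icc 0 T := ⟨ht.trans hsm.1.le, hsm.2.le⟩
    have hsI := Ioo_subset_Icc_self hsm
    by_cases hsG : s ∈ G
    · have hzs : z s = pos Z s := by rw [hzt s hsI, hpZ]
      have hYZ : ∀ i, |pos Y s i - pos Z s i| < η := fun i => by
        rw [hpY, hpZ]; exact hclose s hsI i
      have hZR : ‖pos Z s‖ ≤ R₀ := by rw [hpZ]; exact hZR₀ s hsI
      have hYR : ‖pos Y s‖ ≤ R := by
        obtain ⟨h0, -⟩ | ⟨i, hi, -, -⟩ := hstY
        · rw [h0, norm_zero]; positivity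
        · rw [norm_of_mem_edge hi]
          have h1 := (abs_lt.1 (hYZ i)).2
          have h2 := (le_abs_self _).trans ((abs_coord_le_norm (pos Z s) i).trans hZR)
          linarith
      have hmain := costAlong_ge_of_close (ℓ := ℓ) (ℓs := ℓs) (η := η) (δ := 1 / M) hεpos.le
        (fun i y hy z' hz' hyz => htan₀ i y hy z' hz' (hyz.trans_le hηη₀)) hηM hM.le hs' hstY hstZ
        hYR (hZR.trans (by linarith)) hYZ hsG.1 (by rw [← hzs]; exact hsG.2)
      simp only [hw, indicator_of_mem hsG, hzs, hh]
      simp only [mul_sub] at hmain ⊢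
      linarith
    · simp only [hw, indicator_of_notMem hsG, zero_mul, sub_zero, Finset.sum_const_zero, add_zero,
        zero_sub]
      have h1 : 0 ≤ ε * (1 + ‖vel Y s‖ + ‖vel Z s‖) := by positivity
      have h2 : 0 ≤ C₀ * ‖vel Y s‖ ^ p := by positivity
      linarith
  have hwi : ∀ (X : Sobolev N p t T) i, Integrable (fun s => w i s * vel X s i) μ :=
    fun X i => integrable_mul_Lp_coord (hwm i) (hC i) i X.1.snd
  have hi1 : Integrable (G.indicator h) μ := hhi.indicator hGm
  have hi2 : Integrable (fun s => ∑ i, (w i s * vel Y s i - w i s * vel Z s i)) μ :=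
    integrable_finsetSum _ fun i _ => (hwi Y i).sub (hwi Z i)
  have hi4 : Integrable (fun s => 1 + ‖vel Y s‖) μ := (integrable_const _).add (integrable_vel Y).norm
  have hi3 : Integrable (fun s => ε * (1 + ‖vel Y s‖ + ‖vel Z s‖)) μ :=
    (hi4.add (integrable_vel Z).norm).const_mul ε
  have hi12 : Integrable (fun s => G.indicator h s +
      ∑ i, (w i s * vel Y s i - w i s * vel Z s i)) μ := hi1.add hi2
  have hsum : ∫ s, ∑ i, (w i s * vel Y s i - w i s * vel Z s i) ∂μ =
      (∑ i, ∫ s, w i s * vel Y s i ∂μ) - ∑ i, ∫ s, w i s * vel Z s i ∂μ := by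
    rw [integral_finsetSum _ (fun i _ => by exact (hwi Y i).sub (hwi Z i)),
      ← Finset.sum_sub_distrib]
    exact Finset.sum_congr rfl fun i _ => integral_sub (hwi Y i) (hwi Z i)
  have hint := integral_mono_ae (hi12.sub hi3) (hYi.sub (integrable_const c₀)) hpt
  simp only [Pi.sub_apply] at hint
  have hhint : ∫ s, h s ∂μ = costFunctional ℓ ℓs Z - (T - t) * c₀ := by
    rw [hh, integral_sub (hℓ.integrable_costAlong ht htT hZ) (integrable_const _), hconst]
    rfl
  rw [integral_sub hi12 hi3, integral_add hi1 hi2, integral_indicator hGm,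
    hsum, integral_const_mul,
    integral_add hi4 (integrable_vel Z).norm,
    integral_add (integrable_const _) (integrable_vel Y).norm, hconst,
    integral_sub hYi (integrable_const _), hconst] at hint
  have hεD : ε * ((T - t) * 1 + ∫ s in Ioo t T, ‖vel Y s‖) + ε * ∫ s in Ioo t T, ‖vel Z s‖
      ≤ ε₀ / 4 := by
    have h1 : ε * D = ε₀ / 4 := by rw [hε]; field_simp
    rw [← h1, ← mul_add]
    gcongr
    linarith
  have h5 := (abs_lt.1 hY1).1
  change _ ≤ costFunctional ℓ ℓs Y - _ at hint
  -- Three losses of at most ε₀/4 each (times off G, linear term, tangent error) leave j(Y) > j(Z) -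
  -- ε₀ = c.
  linarith

end

end JunctionControl

/-! ### The main theorem -/

theorem mainTheorem3 {N : ℕ} (hN : 2 ≤ N) {p T : ℝ} [Fact (1 < p)] (hT : 0 < T)
    (ℓ : Fin N → ℝ → ℝ → ℝ → ℝ) (ℓs : ℝ → ℝ) (hℓ : IsRunningCost p T ℓ ℓs) :
    -- lower semicontinuity of the cost functional on `Γ_t[x]`
    (∀ t ∈ Ico 0 T, ∀ x ∈ junction N,
      (∀ Y ∈ admissible p t T x, IntegrableOn (costAlong ℓ ℓs Y) (Ioo t T)) ∧
      LowerSemicontinuousOn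
        (fun Y : WeakSpace ℝ (Sobolev N p t T) =>
          costFunctional ℓ ℓs ((toWeakSpace ℝ (Sobolev N p t T)).symm Y))
        {Y | (toWeakSpace ℝ (Sobolev N p t T)).symm Y ∈ admissible p t T x} ∧
      (∀ (Y : ℕ → Sobolev N p t T) (Z : Sobolev N p t T),
        (∀ n, Y n ∈ admissible p t T x) →
        Tendsto (fun n => toWeakSpace ℝ (Sobolev N p t T) (Y n)) atTop
          (𝓝 (toWeakSpace ℝ (Sobolev N p t T) Z)) →
        Z ∈ admissible p t T x ∧
          (costFunctional ℓ ℓs Z : EReal) ≤ liminf (fun n => (costFunctional ℓ ℓs (Y n) : EReal)) atTop) ∧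
      -- `φ` extends the running cost along admissible trajectories
      (∀ Y ∈ admissible p t T x, ∀ᵐ s ∂(intervalMeasure t T),
        phi ℓ ℓs (pos Y s) (vel Y s) s = (costAlong ℓ ℓs Y s : EReal))) ∧
    -- properties of the convex envelope at the vertex
    ((∀ a : Space N, ∀ s ∈ Icc 0 T, ∃ r : ℝ, vertexEnvelope ℓ ℓs a s = (r : EReal)) ∧
      (∀ s ∈ Icc 0 T, vertexEnvelope ℓ ℓs (0 : Space N) s = (vertexCost ℓ ℓs s : EReal)) ∧
      (∀ a : Space N, LowerSemicontinuousOn (fun s => vertexEnvelope ℓ ℓs a s) (Icc 0 T)) ∧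
      @Measurable (Space N × Icc (0 : ℝ) T) EReal
        (@Prod.instMeasurableSpace _ _ (borel (Space N)) (lebesgueSigma T)) (borel EReal)
        (fun q => vertexEnvelope ℓ ℓs q.1 (q.2 : ℝ))) ∧
    -- properties of the extended integrand
    ((∀ z a : Space N, ∀ s ∈ Icc 0 T, phi ℓ ℓs z a s ≠ ⊥) ∧
      @Measurable (Space N × Space N × Icc (0 : ℝ) T) EReal
        (@Prod.instMeasurableSpace _ _ (borel (Space N))
          (@Prod.instMeasurableSpace _ _ (borel (Space N)) (lebesgueSigma T))) (borel EReal)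
        (fun q => phi ℓ ℓs q.1 q.2.1 (q.2.2 : ℝ)) ∧
      (∀ s ∈ Icc 0 T, LowerSemicontinuous (fun q : Space N × Space N => phi ℓ ℓs q.1 q.2 s)) ∧
      (∀ z : Space N, ∀ s ∈ Icc 0 T, EConvex (fun a : Space N => phi ℓ ℓs z a s))) := by
  have : NeZero N := ⟨by omega⟩
  refine ⟨?_, ?_, ?_⟩
  · intro t ht x _
    have hlsc := hℓ.lowerSemicontinuousOn_costFunctional ht.1 ht.2 x
    refine ⟨fun Y hY => hℓ.integrable_costAlong ht.1 ht.2 hY, hlsc, fun Y Z hY hYZ => ?_,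
      fun Y hY => hℓ.phi_eq_costAlong ht.1 ht.2 hY⟩
    have hZ := mem_admissible_of_tendsto_weak ht.2 hY hYZ
    refine ⟨hZ, le_of_forall_lt fun b hb => ?_⟩
    obtain ⟨c, hbc, hcZ⟩ := EReal.lt_iff_exists_real_btwn.1 hb
    refine hbc.trans_le (le_liminf_of_le (by isBoundedDefault) ?_)
    have h1 := hlsc (toWeakSpace ℝ (Sobolev N p t T) Z) (by simpa using hZ) c
      (by simpa using hcZ)
    have h2 := (tendsto_nhdsWithin_iff.2 ⟨hYZ, Eventually.of_forall fun n => by simpa using hY n⟩).eventually h1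
    filter_upwards [h2] with n hn
    have : c < costFunctional ℓ ℓs (Y n) := by simpa using hn
    exact_mod_cast this.le
  · refine ⟨fun a s hs => ⟨_, (hℓ.coe_vertexEnvelopeReal hs a).symm⟩,
      fun s hs => hℓ.vertexEnvelope_zero hs, fun a s hs y hy => ?_, ?_⟩
    · have := continuous_coe_real_ereal.comp_lowerSemicontinuousOn
        (hℓ.lowerSemicontinuousOn_vertexEnvelopeReal a) EReal.coe_strictMono.monotone s hs y
        (by simpa [hℓ.coe_vertexEnvelopeReal hs] using hy)
      filter_upwards [this, self_mem_nhdsWithin] with s' h1 h2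
      simpa [hℓ.coe_vertexEnvelopeReal h2] using h1
    -- Measurability holds already for the Borel σ-algebra in time, which the Lebesgue one contains.
    · refine hℓ.measurable_vertexEnvelope.mono ?_ le_rfl
      rw [(inferInstance : BorelSpace (Space N)).measurable_eq]
      exact sup_le_sup le_rfl (MeasurableSpace.comap_mono (borel_le_lebesgueSigma T))
  · refine ⟨fun z a s hs => hℓ.phi_ne_bot z a hs, ?_, fun s hs => hℓ.lowerSemicontinuous_phi hT.le hs,
      fun z s hs => hℓ.eConvex_phi z hs⟩
    refine (hℓ.measurable_phi hT.le).mono ?_ le_rfl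
    rw [(inferInstance : BorelSpace (Space N)).measurable_eq]
    exact sup_le_sup le_rfl (MeasurableSpace.comap_mono
      (sup_le_sup le_rfl (MeasurableSpace.comap_mono (borel_le_lebesgueSigma T))))
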